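/- Manifolds are smooth, finite-dimensional, Hausdorff and second countable; in a groupoid $\gamma_2\circ\gamma_1$ is defined when $s(\gamma_2)=t(\gamma_1)$. Let $(G,H,\tau,\alpha)$ be a Lie crossed module and $\mathbb G=[H\rtimes_\alpha G\rightrightarrows G]$ the associated Lie 2-group, with $s(h,g)=g$, $t(h,g)=\tau(h)g$, $(h_2,g_2)\circ(h_1,g_1)=(h_2h_1,g_1)$ and group law $(h_2,g_2)(h_1,g_1)=(h_2\,\alpha_{g_2}(h_1),g_2g_1)$. Its Lie 2-algebra is the groupoid $L(\mathbb G)=[L(H)\oplus L(G)\rightrightarrows L(G)]$ with $s(A,B)=B$, $t(A,B)=\tau_*(A)+B$, $(A_2,B_2)\circ(A_1,B_1)=(A_2+A_1,B_1)$. Let $\mathbb X=[X_1\rightrightarrows X_0]$ be a Lie groupoid and $(\pi\colon E_0\to X_0,\ \mu\colon s^*E_0\to E_0)$ a principal $G$-bundle over $\mathbb X$: a principal (right) $G$-bundle $\pi$ with a smooth map $\mu$ on $s^*E_0=X_1\times_{s,X_0,\pi}E_0$ such that $\pi(\mu(\gamma,p))=t(\gamma)$, $\mu(1_{\pi(p)},p)=p$,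 $\mu(\gamma_2\circ\gamma_1,p)=\mu(\gamma_2,\mu(\gamma_1,p))$ and $\mu(\gamma,p)g=\mu(\gamma,pg)$. Let $\omega$ be a connection on it: an $L(G)$-valued principal connection $1$-form on $E_0\to X_0$ whose pullbacks to $s^*E_0$ along $(\gamma,p)\mapsto p$ and $(\gamma,p)\mapsto\mu(\gamma,p)$ coincide. Let $\mathbb E^{\rm dec}=[s^*E_0\times H\rightrightarrows E_0]$ be the decorated principal $\mathbb G$-bundle over $\mathbb X$: the source and target of $(\gamma,p,h)$ are $p$ and $\mu(\gamma,p)\tau(h^{-1})$; the composition is $(\gamma_2,p_2,h_2)\circ(\gamma_1,p_1,h_1)=(\gamma_2\circ\gamma_1,p_1,h_2h_1)$; the unit at $p$ is $(1_{\pi(p)},p,e)$; the projection is $(\gamma,p,h)\mapsto\gamma$, $p\mapsto\pi(p)$; the action is $(\gamma,p,h)(h',g)=(\gamma,pg,\alpha_{g^{-1}}(h'^{-1}h))$ and $(p,g)\mapsto pg$. Define on $s^*E_0\times H$ the $L(H)\oplus L(G)$-valued $1$-form $$\omega^{\rm dec}_{(\gamma,p,h)}(X,v,\mathfrak K)=\mathrm{Ad}_{(h,e)}\bigl(0,\omega_p(v)\bigr)-\bigl(\mathfrak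 K\cdot h^{-1},0\bigr).$$ An equivariant $L(\mathbb G)$-valued $1$-form on a principal $\mathbb G$-bundle $\mathbb E=[E_1\rightrightarrows E_0]$ is a pair $(\omega_1,\omega_0)$ of smooth $1$-forms, on $E_1$ with values in $L(H)\oplus L(G)$ and on $E_0$ with values in $L(G)$, that is a morphism of Lie groupoids $T\mathbb E\to L(\mathbb G)$ and satisfies $\omega_i(v\cdot k)=\mathrm{Ad}_{k^{-1}}\omega_i(v)$. With $\delta\colon\mathbb E\times L(\mathbb G)\to T\mathbb E$ the functor of fundamental vector fields, it is a strict connection $1$-form if $\omega\circ\delta=\mathrm{pr}_2$, and a semi-strict connection $1$-form if there is a smooth, $\mathbb G$-equivariant, fibrewise linear natural isomorphism $\omega\circ\delta\Rightarrow\mathrm{pr}_2$. Then $(\omega^{\rm dec},\omega)$ is a strict connection $1$-form on $\mathbb E^{\rm dec}$. Moreover, for every smooth $L(H)$-valued $1$-form $\lambda$ on $E_0$ with $\lambda_{pg}(v\cdot g)=(\alpha_{g^{-1}})_*\lambda_p(v)$, the pair $$\widetilde\omega_1=\omega^{\rm dec}+\bigl(t^*\lambda-s^*\lambda,\ \tau_*(s^*\lambda)\bigr),\qquad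 \widetilde\omega_0=\omega+\tau_*(\lambda),$$ where $s,t$ are the source and target maps of $\mathbb E^{\rm dec}$, is a semi-strict connection $1$-form on $\mathbb E^{\rm dec}$. -/

import Mathlib

open scoped Manifold ContDiff

noncomputable section

section Basic

variable {EG MG EM MM EP MP EN MN : Type*}
  [NormedAddCommGroup EG] [NormedSpace ℝ EG] [TopologicalSpace MG]
  [NormedAddCommGroup EM] [NormedSpace ℝ EM] [TopologicalSpace MM]
  [NormedAddCommGroup EP] [NormedSpace ℝ EP] [TopologicalSpace MP]
  [NormedAddCommGroup EN] [NormedSpace ℝ EN] [TopologicalSpace MN]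

/-- The adjoint action of `g` on the Lie algebra: the differential at `1` of `x ↦ g x g⁻¹`. -/
def lieAd (IG : ModelWithCorners ℝ EG MG) {G : Type*} [TopologicalSpace G] [ChartedSpace MG G]
    [Group G] (g : G) : GroupLieAlgebra IG G →L[ℝ] GroupLieAlgebra IG G :=
  mfderiv IG IG (fun x : G => g * x * g⁻¹) 1

/-- The map `K ↦ K · h⁻¹` from `T_h G` to the Lie algebra. -/
def rightTranslateToOne (IG : ModelWithCorners ℝ EG MG) {G : Type*} [TopologicalSpace G]
    [ChartedSpace MG G] [Group G] (h : G) : TangentSpace IG h →L[ℝ] GroupLieAlgebra IG G :=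
  mfderiv IG IG (fun x : G => x * h⁻¹) h

/-- The velocity at `0` of a curve. -/
def velocity (IM : ModelWithCorners ℝ EM MM) {M : Type*} [TopologicalSpace M] [ChartedSpace MM M]
    (c : ℝ → M) : TangentBundle IM M :=
  ⟨c 0, mfderiv 𝓘(ℝ, ℝ) IM c 0 (1 : ℝ)⟩

/-- A (not necessarily smooth) `1`-form on `M` with values in the Lie algebra of `G`. -/
abbrev LieForm (IM : ModelWithCorners ℝ EM MM) (M : Type*) [TopologicalSpace M]
    [ChartedSpace MM M] (IG : ModelWithCorners ℝ EG MG) (G : Type*) [TopologicalSpace G]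
    [ChartedSpace MG G] [Group G] : Type _ :=
  ∀ p : M, TangentSpace IM p →L[ℝ] GroupLieAlgebra IG G

/-- Smoothness of a Lie algebra valued `1`-form, as a fibrewise linear map `TM → L(G)`. -/
def LieForm.IsSmooth {IM : ModelWithCorners ℝ EM MM} {M : Type*} [TopologicalSpace M]
    [ChartedSpace MM M] [IsManifold IM ∞ M] {IG : ModelWithCorners ℝ EG MG} {G : Type*}
    [TopologicalSpace G]
    [ChartedSpace MG G] [Group G] (θ : LieForm IM M IG G) : Prop :=
  ContMDiff (M' := EG) IM.tangent 𝓘(ℝ, EG) ∞ (fun v : TangentBundle IM M => (θ v.1 v.2 : EG))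

/-- A smooth principal bundle `P → M` with structure group `G` (acting on the right). -/
structure PrincipalBundle (IG : ModelWithCorners ℝ EG MG) (IP : ModelWithCorners ℝ EP MP)
    (IM : ModelWithCorners ℝ EM MM) (G P M : Type*)
    [TopologicalSpace G] [ChartedSpace MG G] [Group G]
    [TopologicalSpace P] [ChartedSpace MP P] [TopologicalSpace M] [ChartedSpace MM M] where
  /-- the bundle projection -/
  proj : C^∞⟮IP, P; IM, M⟯
  /-- the right action `(p, g) ↦ p g` -/
  act : P → G → P
  contMDiff_act : ContMDiff (IP.prod IG) IP ∞ (fun x : P × G => act x.1 x.2)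
  act_one : ∀ p, act p 1 = p
  act_mul : ∀ p g g', act p (g * g') = act (act p g) g'
  proj_act : ∀ p g, proj (act p g) = proj p
  /-- smooth `G`-equivariant local trivializations around every point of the base -/
  locally_trivial : ∀ x : M, ∃ e : Bundle.Trivialization G proj, x ∈ e.baseSet ∧
    ContMDiffOn IP (IM.prod IG) ∞ e.toOpenPartialHomeomorph e.source ∧
    ContMDiffOn (IM.prod IG) IP ∞ e.toOpenPartialHomeomorph.symm e.target ∧
    ∀ p ∈ e.source, ∀ g, (e (act p g)).2 = (e p).2 * g

namespace PrincipalBundle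

variable {IG : ModelWithCorners ℝ EG MG} {IP : ModelWithCorners ℝ EP MP}
  {IM : ModelWithCorners ℝ EM MM} {G P M : Type*}
  [TopologicalSpace G] [ChartedSpace MG G] [Group G]
  [TopologicalSpace P] [ChartedSpace MP P] [TopologicalSpace M] [ChartedSpace MM M]

/-- The differential `v ↦ v · g` of the right translation by `g`. -/
def actDeriv (B : PrincipalBundle IG IP IM G P M) (p : P) (g : G) :
    TangentSpace IP p →L[ℝ] TangentSpace IP (B.act p g) :=
  mfderiv IP IP (fun q => B.act q g) p

/-- The fundamental vector field map `δ_p : L(G) → T_p P`. -/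
def fundamental (B : PrincipalBundle IG IP IM G P M) (p : P) :
    GroupLieAlgebra IG G →L[ℝ] TangentSpace IP p :=
  mfderiv IG IP (fun g => B.act p g) 1

/-- A connection `1`-form on a principal bundle. -/
structure IsConnection [IsManifold IP ∞ P] (B : PrincipalBundle IG IP IM G P M)
    (θ : LieForm IP P IG G) : Prop where
  smooth : θ.IsSmooth
  equivariant : ∀ p g v, θ (B.act p g) (B.actDeriv p g v) = lieAd IG g⁻¹ (θ p v)
  vertical : ∀ p A, θ p (B.fundamental p A) = A

variable {IN : ModelWithCorners ℝ EN MN} {N : Type*} [TopologicalSpace N] [ChartedSpace MN N]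

/-- The total space of the pullback of a principal bundle along a smooth map `f : N → M`. -/
def Pullback (B : PrincipalBundle IG IP IM G P M) (f : C^∞⟮IN, N; IM, M⟯) : Type _ :=
  {z : N × P // f z.1 = B.proj z.2}

namespace Pullback

variable (B : PrincipalBundle IG IP IM G P M) (f : C^∞⟮IN, N; IM, M⟯)

variable {B f} in
/-- The point `(x, p)` of the pullback. -/
def mk (x : N) (p : P) (h : f x = B.proj p) : B.Pullback f := ⟨(x, p), h⟩

variable {B f} in
/-- The projection of the pullback to `N`. -/
def fst (z : B.Pullback f) : N := z.1.1

variable {B f} in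
/-- The projection of the pullback to `P`. -/
def snd (z : B.Pullback f) : P := z.1.2

variable {B f} in
theorem prop (z : B.Pullback f) : f z.fst = B.proj z.snd := z.2

instance : TopologicalSpace (B.Pullback f) :=
  inferInstanceAs (TopologicalSpace {z : N × P // f z.1 = B.proj z.2})

instance [T2Space N] [T2Space P] : T2Space (B.Pullback f) :=
  inferInstanceAs (T2Space {z : N × P // f z.1 = B.proj z.2})

instance [SecondCountableTopology N] [SecondCountableTopology P] :
    SecondCountableTopology (B.Pullback f) :=
  TopologicalSpace.Subtype.secondCountableTopology {z : N × P | f z.1 = B.proj z.2}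

theorem continuous_fst : Continuous (fst : B.Pullback f → N) :=
  _root_.continuous_fst.comp continuous_subtype_val

theorem continuous_snd : Continuous (snd : B.Pullback f → P) :=
  _root_.continuous_snd.comp continuous_subtype_val

open Classical in
/-- The local trivialization of the pullback induced by a local trivialization of `P`:
`(x, p) ↦ (x, φ p)`. -/
def trivChart (e : Bundle.Trivialization G B.proj) (z₀ : B.Pullback f) :
    OpenPartialHomeomorph (B.Pullback f) (N × G) where
  toFun z := (z.fst, (e z.snd).2)
  invFun y := if h : f y.1 ∈ e.baseSet then
      mk y.1 (e.toOpenPartialHomeomorph.symm (f y.1, y.2)) (e.proj_symm_apply' h).symm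
    else z₀
  source := {z | f z.fst ∈ e.baseSet}
  target := {y | f y.1 ∈ e.baseSet}
  map_source' z hz := hz
  map_target' y hy := by
    have hy' : f y.1 ∈ e.baseSet := hy
    simp only [hy', dif_pos]
    exact hy
  left_inv' z hz := by
    have hz' : f z.fst ∈ e.baseSet := hz
    simp only [hz', dif_pos]
    apply Subtype.ext
    refine Prod.ext rfl ?_
    show e.toOpenPartialHomeomorph.symm (f z.fst, (e z.snd).2) = z.snd
    rw [z.prop] at hz' ⊢
    exact e.symm_apply_mk_proj (e.mem_source.2 hz')
  right_inv' y hy := by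
    have hy' : f y.1 ∈ e.baseSet := hy
    simp only [hy', dif_pos]
    refine Prod.ext rfl ?_
    show (e (e.toOpenPartialHomeomorph.symm (f y.1, y.2))).2 = y.2
    rw [e.apply_symm_apply' hy']
  open_source := e.open_baseSet.preimage (f.contMDiff.continuous.comp (continuous_fst B f))
  open_target := e.open_baseSet.preimage (f.contMDiff.continuous.comp _root_.continuous_fst)
  continuousOn_toFun := by
    refine (continuous_fst B f).continuousOn.prodMk (_root_.continuous_snd.comp_continuousOn
      (e.continuousOn_toFun.comp (continuous_snd B f).continuousOn ?_))
    intro z hz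
    have hz' : f z.fst ∈ e.baseSet := hz
    rw [z.prop] at hz'
    exact e.mem_source.2 hz'
  continuousOn_invFun := by
    have h1 : ContinuousOn (fun y : N × G => (y.1, e.toOpenPartialHomeomorph.symm (f y.1, y.2)))
        {y | f y.1 ∈ e.baseSet} := by
      refine _root_.continuous_fst.continuousOn.prodMk
        (e.toOpenPartialHomeomorph.continuousOn_symm.comp
          ((f.contMDiff.continuous.comp _root_.continuous_fst).prodMk
            _root_.continuous_snd).continuousOn ?_)
      intro y hy
      exact e.mem_target.2 hy
    refine (Topology.IsInducing.subtypeVal.continuousOn_iff).2 (h1.congr ?_)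
    intro y hy
    have hy' : f y.1 ∈ e.baseSet := hy
    simp only [Function.comp, hy', dif_pos]
    rfl

/-- A chosen local trivialization around a point of the base. -/
def _root_.PrincipalBundle.triv (x : M) : Bundle.Trivialization G B.proj :=
  (B.locally_trivial x).choose

theorem _root_.PrincipalBundle.mem_triv (x : M) : x ∈ (B.triv x).baseSet :=
  (B.locally_trivial x).choose_spec.1

/-- The pullback is locally modelled on `N × G`. -/
@[reducible] def chartedSpaceProd : ChartedSpace (N × G) (B.Pullback f) where
  atlas := {c | ∃ (x : M) (z₀ : B.Pullback f), c = trivChart B f (B.triv x) z₀}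
  chartAt z := trivChart B f (B.triv (f z.fst)) z
  mem_chart_source z := B.mem_triv (f z.fst)
  chart_mem_atlas _ := ⟨_, _, rfl⟩

instance : ChartedSpace (ModelProd MN MG) (B.Pullback f) :=
  letI := chartedSpaceProd B f
  ChartedSpace.comp (ModelProd MN MG) (N × G) (B.Pullback f)

open Classical in
theorem trivChart_contMDiffOn_transition (x x' : M) (z₀ z₀' : B.Pullback f) :
    ContMDiffOn (IN.prod IG) (IN.prod IG) ∞
      ((trivChart B f (B.triv x) z₀).symm.trans (trivChart B f (B.triv x') z₀'))
      ((trivChart B f (B.triv x) z₀).symm.trans (trivChart B f (B.triv x') z₀')).source := by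
  obtain ⟨-, -, h2, -⟩ := (B.locally_trivial x).choose_spec
  obtain ⟨-, h1', -, -⟩ := (B.locally_trivial x').choose_spec
  change ContMDiffOn _ _ _ _ (B.triv x).target at h2
  change ContMDiffOn _ _ _ _ (B.triv x').source at h1'
  have hs : ∀ y : N × G, y ∈ ((trivChart B f (B.triv x) z₀).symm.trans
      (trivChart B f (B.triv x') z₀')).source → f y.1 ∈ (B.triv x).baseSet ∧
      f y.1 ∈ (B.triv x').baseSet := by
    intro y hy
    rw [OpenPartialHomeomorph.trans_source] at hy
    have h1 : f y.1 ∈ (B.triv x).baseSet := hy.1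
    have h2 : f ((trivChart B f (B.triv x) z₀).symm y).fst ∈ (B.triv x').baseSet := hy.2
    refine ⟨h1, ?_⟩
    have : ((trivChart B f (B.triv x) z₀).symm y).fst = y.1 := by
      show Pullback.fst (dite _ _ _) = _
      rw [dif_pos h1]; rfl
    rwa [this] at h2
  have key : ContMDiffOn (IN.prod IG) (IN.prod IG) ∞ (fun y : N × G =>
      (y.1, ((B.triv x').toOpenPartialHomeomorph
        ((B.triv x).toOpenPartialHomeomorph.symm (f y.1, y.2))).2))
      ((trivChart B f (B.triv x) z₀).symm.trans (trivChart B f (B.triv x') z₀')).source := by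
    have hf : ContMDiff (IN.prod IG) (IM.prod IG) ∞ (fun y : N × G => (f y.1, y.2)) :=
      (f.contMDiff.comp contMDiff_fst).prodMk contMDiff_snd
    have hA := h2.comp hf.contMDiffOn (s := ((trivChart B f (B.triv x) z₀).symm.trans
      (trivChart B f (B.triv x') z₀')).source)
      (fun y hy => (B.triv x).mem_target.2 (hs y hy).1)
    refine contMDiffOn_fst.prodMk (contMDiff_snd.comp_contMDiffOn (h1'.comp hA ?_))
    intro y hy
    refine (B.triv x').mem_source.2 ?_
    show B.proj ((B.triv x).toOpenPartialHomeomorph.symm (f y.1, y.2)) ∈ _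
    rw [(B.triv x).proj_symm_apply' (hs y hy).1]
    exact (hs y hy).2
  refine key.congr ?_
  intro y hy
  have h1 := (hs y hy).1
  show trivChart B f (B.triv x') z₀' (dite _ _ _) = _
  rw [dif_pos h1]
  rfl

instance [IsManifold IN ∞ N] [IsManifold IG ∞ G] :
    IsManifold (IN.prod IG) ∞ (B.Pullback f) := by
  let _ := chartedSpaceProd B f
  refine isManifold_of_contDiffOn (IN.prod IG) ∞ (B.Pullback f) ?_
  rintro _ _ ⟨_, ⟨x, z₀, rfl⟩, ψ, hψ, rfl⟩ ⟨_, ⟨x', z₀', rfl⟩, ψ', hψ', rfl⟩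
  have hψ1 := contMDiffOn_symm_of_mem_maximalAtlas (I := IN.prod IG) (n := ∞)
    (StructureGroupoid.subset_maximalAtlas _ hψ)
  have hψ2 := contMDiffOn_of_mem_maximalAtlas (I := IN.prod IG) (n := ∞)
    (StructureGroupoid.subset_maximalAtlas _ hψ')
  have hT := trivChart_contMDiffOn_transition B f (IG := IG) (IN := IN) x x' z₀ z₀'
  refine ContMDiffOn.contDiffOn ?_
  refine (IN.prod IG).contMDiff.comp_contMDiffOn ?_
  have h : ContMDiffOn (IN.prod IG) (IN.prod IG) ∞
      (ψ' ∘ ((trivChart B f (B.triv x) z₀).symm.trans (trivChart B f (B.triv x') z₀')) ∘ ψ.symm)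
      (((trivChart B f (B.triv x) z₀).trans ψ).symm.trans
        ((trivChart B f (B.triv x') z₀').trans ψ')).source := by
    refine hψ2.comp (hT.comp (hψ1.mono ?_) ?_) ?_
    all_goals
      intro y hy
      simp only [mfld_simps] at hy ⊢
      tauto
  refine h.comp ((IN.prod IG).contMDiffOn_symm.mono Set.inter_subset_right) ?_
  intro y hy
  exact hy.1

variable {B f}

theorem contMDiffOn_trivChart [IsManifold IN ∞ N] [IsManifold IG ∞ G] (x : M)
    (z₀ : B.Pullback f) : ContMDiffOn (IN.prod IG) (IN.prod IG) ∞ (trivChart B f (B.triv x) z₀)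
      {z | f z.fst ∈ (B.triv x).baseSet} := by
  intro z hz
  let _ := chartedSpaceProd B f
  set c := trivChart B f (B.triv x) z₀
  have hc : c.trans (chartAt (ModelProd MN MG) (c z)) ∈ atlas (ModelProd MN MG) (B.Pullback f) :=
    ⟨c, ⟨x, z₀, rfl⟩, _, chart_mem_atlas _ _, rfl⟩
  have h1 := contMDiffAt_of_mem_maximalAtlas (I := IN.prod IG) (n := ∞) (x := z)
    (StructureGroupoid.subset_maximalAtlas _ hc) ⟨hz, mem_chart_source (ModelProd MN MG) (c z)⟩
  have h2 := (contMDiffOn_chart_symm (I := IN.prod IG) (n := ∞) (x := c z)).contMDiffAt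
    ((chartAt (ModelProd MN MG) (c z)).open_target.mem_nhds (mem_chart_target _ _))
  refine ContMDiffAt.contMDiffWithinAt ?_
  refine (ContMDiffAt.comp z (by exact h2) h1).congr_of_eventuallyEq ?_
  have : c ⁻¹' (chartAt (ModelProd MN MG) (c z)).source ∩ c.source ∈ nhds z := by
    rw [Set.inter_comm]
    exact (c.isOpen_inter_preimage (chartAt _ _).open_source).mem_nhds ⟨hz, mem_chart_source (ModelProd MN MG) (c z)⟩
  filter_upwards [this] with y hy
  simp only [Function.comp, OpenPartialHomeomorph.coe_trans]
  rw [(chartAt (ModelProd MN MG) (c z)).left_inv hy.1]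

theorem contMDiffOn_trivChart_symm [IsManifold IN ∞ N] [IsManifold IG ∞ G] (x : M)
    (z₀ : B.Pullback f) : ContMDiffOn (IN.prod IG) (IN.prod IG) ∞
      (trivChart B f (B.triv x) z₀).symm {y | f y.1 ∈ (B.triv x).baseSet} := by
  intro y hy
  let _ := chartedSpaceProd B f
  set c := trivChart B f (B.triv x) z₀
  have hc : c.trans (chartAt (ModelProd MN MG) y) ∈ atlas (ModelProd MN MG) (B.Pullback f) :=
    ⟨c, ⟨x, z₀, rfl⟩, _, chart_mem_atlas _ _, rfl⟩
  have hy' : y ∈ c.target := hy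
  have h1 := contMDiffAt_symm_of_mem_maximalAtlas (I := IN.prod IG) (n := ∞)
    (x := chartAt (ModelProd MN MG) y y)
    (StructureGroupoid.subset_maximalAtlas _ hc) ⟨mem_chart_target _ y, by
      show (chartAt (ModelProd MN MG) y).symm (chartAt (ModelProd MN MG) y y) ∈ c.target
      rw [(chartAt (ModelProd MN MG) y).left_inv (mem_chart_source _ y)]
      exact hy'⟩
  have h2 := (contMDiffOn_chart (I := IN.prod IG) (n := ∞) (x := y)).contMDiffAt
    ((chartAt (ModelProd MN MG) y).open_source.mem_nhds (mem_chart_source _ _))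
  refine ContMDiffAt.contMDiffWithinAt ?_
  refine (ContMDiffAt.comp y (by exact h1) h2).congr_of_eventuallyEq ?_
  filter_upwards [(chartAt (ModelProd MN MG) y).open_source.mem_nhds (mem_chart_source _ _)]
    with w hw
  simp only [Function.comp, OpenPartialHomeomorph.coe_trans_symm]
  rw [(chartAt (ModelProd MN MG) y).left_inv hw]

theorem contMDiff_fst [IsManifold IN ∞ N] [IsManifold IG ∞ G] :
    ContMDiff (IN.prod IG) IN ∞ (fst : B.Pullback f → N) := by
  intro z
  have h := (contMDiffOn_trivChart (IN := IN) (IG := IG) (f z.fst) z).contMDiffAt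
    (((B.triv (f z.fst)).open_baseSet.preimage
      (f.contMDiff.continuous.comp (continuous_fst B f))).mem_nhds (B.mem_triv _))
  exact (_root_.contMDiff_fst (I := IN) (J := IG) (M := N) (N := G)).contMDiffAt.comp z h

theorem contMDiff_snd [IsManifold IN ∞ N] [IsManifold IG ∞ G] :
    ContMDiff (IN.prod IG) IP ∞ (snd : B.Pullback f → P) := by
  intro z
  obtain ⟨-, -, h2, -⟩ := (B.locally_trivial (f z.fst)).choose_spec
  change ContMDiffOn _ _ _ _ (B.triv (f z.fst)).target at h2
  have hU : {z' : B.Pullback f | f z'.fst ∈ (B.triv (f z.fst)).baseSet} ∈ nhds z :=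
    ((B.triv (f z.fst)).open_baseSet.preimage
      (f.contMDiff.continuous.comp (continuous_fst B f))).mem_nhds (B.mem_triv _)
  have h := (contMDiffOn_trivChart (IN := IN) (IG := IG) (f z.fst) z)
  have h3 : ContMDiffOn (IN.prod IG) (IM.prod IG) ∞
      (fun z' : B.Pullback f => (f z'.fst, (trivChart B f (B.triv (f z.fst)) z z').2))
      {z' : B.Pullback f | f z'.fst ∈ (B.triv (f z.fst)).baseSet} :=
    (f.contMDiff.comp contMDiff_fst).contMDiffOn.prodMk (_root_.contMDiff_snd.comp_contMDiffOn h)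
  have h4 := h2.comp h3 (fun y hy => (B.triv (f z.fst)).mem_target.2 hy)
  refine (h4.contMDiffAt hU).congr_of_eventuallyEq ?_
  filter_upwards [hU] with y hy
  have hy' : f y.fst ∈ (B.triv (f z.fst)).baseSet := hy
  show y.snd = (B.triv (f z.fst)).toOpenPartialHomeomorph.symm
    (f y.fst, ((B.triv (f z.fst)) y.snd).2)
  rw [y.prop] at hy' ⊢
  exact ((B.triv (f z.fst)).symm_apply_mk_proj ((B.triv (f z.fst)).mem_source.2 hy')).symm

/-- A map into the pullback is smooth when its two components are. -/
theorem contMDiffWithinAt_of_comp [IsManifold IN ∞ N] [IsManifold IG ∞ G]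
    {EQ MQ : Type*} [NormedAddCommGroup EQ] [NormedSpace ℝ EQ] [TopologicalSpace MQ]
    {IQ : ModelWithCorners ℝ EQ MQ} {Q : Type*} [TopologicalSpace Q] [ChartedSpace MQ Q]
    {F : Q → B.Pullback f} {S : Set Q} {q : Q}
    (h1 : ContMDiffWithinAt IQ IN ∞ (fun y => (F y).fst) S q)
    (h2 : ContMDiffWithinAt IQ IP ∞ (fun y => (F y).snd) S q) :
    ContMDiffWithinAt IQ (IN.prod IG) ∞ F S q := by
  set e := B.triv (f (F q).fst) with he
  set c := trivChart B f e (F q) with hcdef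
  obtain ⟨-, ht, -, -⟩ := (B.locally_trivial (f (F q).fst)).choose_spec
  change ContMDiffOn _ _ _ _ e.source at ht
  have hmem : f (F q).fst ∈ e.baseSet := B.mem_triv _
  have hmem2 : (F q).snd ∈ e.source := by
    rw [e.mem_source, ← (F q).prop]; exact hmem
  have h3 : ContMDiffWithinAt IQ (IN.prod IG) ∞ (fun y => c (F y)) S q :=
    h1.prodMk (_root_.contMDiff_snd.contMDiffAt.comp_contMDiffWithinAt q
      ((ht.contMDiffAt (e.open_source.mem_nhds hmem2)).comp_contMDiffWithinAt q h2))
  have h4 : ContMDiffAt (IN.prod IG) (IN.prod IG) ∞ c.symm (c (F q)) :=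
    (contMDiffOn_trivChart_symm (IN := IN) (IG := IG) (f (F q).fst) (F q)).contMDiffAt
      (c.open_target.mem_nhds (c.map_source hmem))
  refine (ContMDiffAt.comp_contMDiffWithinAt q h4 h3).congr_of_eventuallyEq ?_ ?_
  · have : (fun y => (F y).fst) ⁻¹' (f ⁻¹' e.baseSet) ∈ nhdsWithin q S :=
      h1.continuousWithinAt ((e.open_baseSet.preimage f.contMDiff.continuous).mem_nhds hmem)
    filter_upwards [this] with y hy
    exact (c.left_inv hy).symm
  · exact (c.left_inv hmem).symm

end Pullback

end PrincipalBundle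

end Basic

section Pullback2

namespace PrincipalBundle.Pullback

variable {EG MG EM MM EP MP EN MN : Type*}
  [NormedAddCommGroup EG] [NormedSpace ℝ EG] [TopologicalSpace MG]
  [NormedAddCommGroup EM] [NormedSpace ℝ EM] [TopologicalSpace MM]
  [NormedAddCommGroup EP] [NormedSpace ℝ EP] [TopologicalSpace MP]
  [NormedAddCommGroup EN] [NormedSpace ℝ EN] [TopologicalSpace MN]
  {IG : ModelWithCorners ℝ EG MG} {IP : ModelWithCorners ℝ EP MP}
  {IM : ModelWithCorners ℝ EM MM} {G P M : Type*}
  [TopologicalSpace G] [ChartedSpace MG G] [Group G]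
  [TopologicalSpace P] [ChartedSpace MP P] [TopologicalSpace M] [ChartedSpace MM M]
  {IN : ModelWithCorners ℝ EN MN} {N : Type*} [TopologicalSpace N] [ChartedSpace MN N]
  {B : PrincipalBundle IG IP IM G P M} {f : C^∞⟮IN, N; IM, M⟯}

theorem contMDiff_of_comp [IsManifold IN ∞ N] [IsManifold IG ∞ G]
    {EQ MQ : Type*} [NormedAddCommGroup EQ] [NormedSpace ℝ EQ] [TopologicalSpace MQ]
    {IQ : ModelWithCorners ℝ EQ MQ} {Q : Type*} [TopologicalSpace Q] [ChartedSpace MQ Q]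
    {F : Q → B.Pullback f} (h1 : ContMDiff IQ IN ∞ (fun y => (F y).fst))
    (h2 : ContMDiff IQ IP ∞ (fun y => (F y).snd)) :
    ContMDiff IQ (IN.prod IG) ∞ F :=
  fun q => contMDiffWithinAt_of_comp (h1 q) (h2 q)

open Classical in
/-- The projection of the pullback along a submersion to the total space is a submersion. -/
theorem surjective_mfderiv_snd [IsManifold IN ∞ N] [IsManifold IG ∞ G] (z : B.Pullback f)
    (hf : Function.Surjective (mfderiv IN IM f z.fst)) :
    Function.Surjective (mfderiv (IN.prod IG) IP (snd : B.Pullback f → P) z) := by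
  intro w
  set e := B.triv (f z.fst) with he
  set c := trivChart B f e z with hcdef
  obtain ⟨-, h1, h2, -⟩ := (B.locally_trivial (f z.fst)).choose_spec
  change ContMDiffOn _ _ _ _ e.source at h1
  change ContMDiffOn _ _ _ _ e.target at h2
  have hmem : f z.fst ∈ e.baseSet := B.mem_triv _
  have hmem2 : z.snd ∈ e.source := by
    rw [e.mem_source, ← z.prop]; exact hmem
  have d1 : MDifferentiableAt IP (IM.prod IG) e.toOpenPartialHomeomorph z.snd :=
    (h1.contMDiffAt (e.open_source.mem_nhds hmem2)).mdifferentiableAt (by simp)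
  have hez : e.toOpenPartialHomeomorph z.snd = (f z.fst, (e z.snd).2) := by
    rw [z.prop]; exact (Prod.ext (e.proj_toFun _ hmem2) rfl)
  have d2 : MDifferentiableAt (IM.prod IG) IP e.toOpenPartialHomeomorph.symm
      (f z.fst, (e z.snd).2) :=
    (h2.contMDiffAt (e.open_target.mem_nhds (e.mem_target.2 hmem))).mdifferentiableAt (by simp)
  have d3 : MDifferentiableAt (IN.prod IG) (IM.prod IG) (fun y : N × G => (f y.1, y.2))
      (z.fst, (e z.snd).2) :=
    ((f.contMDiff.comp _root_.contMDiff_fst).prodMk _root_.contMDiff_snd).mdifferentiableAt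
      (by simp)
  have d4 : MDifferentiableAt (IN.prod IG) (IN.prod IG) c.symm (z.fst, (e z.snd).2) :=
    ((contMDiffOn_trivChart_symm (IN := IN) (IG := IG) (f z.fst) z).contMDiffAt
      (c.open_target.mem_nhds (c.map_source hmem))).mdifferentiableAt (by simp)
  have hcz : c.symm (z.fst, (e z.snd).2) = z := c.left_inv hmem
  have d5 : MDifferentiableAt (IN.prod IG) IP (snd : B.Pullback f → P)
      (c.symm (z.fst, (e z.snd).2)) := contMDiff_snd.mdifferentiableAt (by simp)
  -- `snd ∘ c.symm = e.symm ∘ (f × id)` near the point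
  have hev : (snd ∘ c.symm : N × G → P) =ᶠ[nhds (z.fst, (e z.snd).2)]
      e.toOpenPartialHomeomorph.symm ∘ (fun y : N × G => (f y.1, y.2)) := by
    filter_upwards [c.open_target.mem_nhds (c.map_source hmem)] with y hy
    have hy' : f y.1 ∈ e.baseSet := hy
    show snd (dite _ _ _) = _
    rw [dif_pos hy']
    rfl
  have hev2 : (e.toOpenPartialHomeomorph.symm ∘ e.toOpenPartialHomeomorph : P → P)
      =ᶠ[nhds z.snd] id := by
    filter_upwards [e.open_source.mem_nhds hmem2] with y hy
    exact e.toOpenPartialHomeomorph.left_inv hy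
  have hev3 : (Prod.fst ∘ e.toOpenPartialHomeomorph : P → M) =ᶠ[nhds z.snd] B.proj := by
    filter_upwards [e.open_source.mem_nhds hmem2] with y hy
    exact e.proj_toFun _ hy
  obtain ⟨X, hX⟩ := hf (mfderiv IP IM B.proj z.snd w)
  have hX' : (mfderiv IN IM f z.fst X : EM) = mfderiv IP IM B.proj z.snd w := hX
  have c1 := mfderiv_comp (z.fst, (e z.snd).2) d5 d4
  have c2 := mfderiv_comp (z.fst, (e z.snd).2) (f := fun y : N × G => (f y.1, y.2)) d2 d3
  rw [← hev.mfderiv_eq, c1] at c2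
  have d3' : mfderiv (IN.prod IG) (IM.prod IG) (fun y : N × G => (f y.1, y.2))
      (z.fst, (e z.snd).2) = (mfderiv IN IM f z.fst).prodMap
        (ContinuousLinearMap.id ℝ (TangentSpace IG (e z.snd).2)) := by
    have := mfderiv_prodMap (p := (z.fst, (e z.snd).2)) (f := f) (g := (id : G → G))
      (f.contMDiff.mdifferentiableAt (I := IN) (I' := IM) (by simp))
      (mdifferentiableAt_id (I := IG))
    rw [mfderiv_id] at this
    exact this
  have c3 : (mfderiv IP (IM.prod IG) e.toOpenPartialHomeomorph z.snd w : EM × EG).1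
      = mfderiv IP IM B.proj z.snd w := by
    rw [← hev3.mfderiv_eq, mfderiv_comp z.snd mdifferentiableAt_fst d1, mfderiv_fst]
    rfl
  have c4 : mfderiv (IM.prod IG) IP e.toOpenPartialHomeomorph.symm (f z.fst, (e z.snd).2)
      (mfderiv IP (IM.prod IG) e.toOpenPartialHomeomorph z.snd w : EM × EG) = (w : EP) := by
    have d2' := d2
    rw [← hez] at d2'
    have := mfderiv_comp z.snd d2' d1
    rw [hev2.mfderiv_eq, mfderiv_id] at this
    rw [← hez]
    exact (congrArg (fun T => T w) this).symm
  let Y : EG := (mfderiv IP (IM.prod IG) e.toOpenPartialHomeomorph z.snd w : EM × EG).2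
  have c5 := congrArg (fun T => T ((X, Y) : EN × EG)) c2
  rw [d3'] at c5
  let Z : EN × EG := mfderiv (IN.prod IG) (IN.prod IG) c.symm (z.fst, (e z.snd).2)
    ((X, Y) : EN × EG)
  have c6 : mfderiv (IN.prod IG) IP (snd : B.Pullback f → P)
      (c.symm (z.fst, (e z.snd).2)) Z = (w : EP) := by
    refine Eq.trans c5 (Eq.trans ?_ c4)
    refine congrArg (fun v : EM × EG => mfderiv (IM.prod IG) IP e.toOpenPartialHomeomorph.symm
      (f z.fst, (e z.snd).2) v) ?_
    exact Prod.ext (hX'.trans c3.symm) rfl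
  clear_value Z
  rw [hcz] at c6
  exact ⟨Z, c6⟩

end PrincipalBundle.Pullback

end Pullback2

section Groupoids

variable {E1 M1 E0 M0 EG MG EH MH EP MP : Type*}
  [NormedAddCommGroup E1] [NormedSpace ℝ E1] [TopologicalSpace M1]
  [NormedAddCommGroup E0] [NormedSpace ℝ E0] [TopologicalSpace M0]
  [NormedAddCommGroup EG] [NormedSpace ℝ EG] [TopologicalSpace MG]
  [NormedAddCommGroup EH] [NormedSpace ℝ EH] [TopologicalSpace MH]
  [NormedAddCommGroup EP] [NormedSpace ℝ EP] [TopologicalSpace MP]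

/-- A Lie groupoid `[X₁ ⇉ X₀]`. The composite `γ₂ ∘ γ₁` is `comp γ₂ γ₁`; it is only meaningful when
`s γ₂ = t γ₁`, and it is required to be smooth on the set of composable pairs only. -/
structure LieGroupoid (I1 : ModelWithCorners ℝ E1 M1) (I0 : ModelWithCorners ℝ E0 M0)
    (X1 X0 : Type*) [TopologicalSpace X1] [ChartedSpace M1 X1]
    [TopologicalSpace X0] [ChartedSpace M0 X0] where
  /-- the source map -/
  s : C^∞⟮I1, X1; I0, X0⟯
  /-- the target map -/
  t : C^∞⟮I1, X1; I0, X0⟯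
  /-- the unit map -/
  unit : C^∞⟮I0, X0; I1, X1⟯
  /-- the inverse map -/
  inv : C^∞⟮I1, X1; I1, X1⟯
  /-- the composition -/
  comp : X1 → X1 → X1
  s_submersion : ∀ γ, Function.Surjective (mfderiv I1 I0 s γ)
  t_submersion : ∀ γ, Function.Surjective (mfderiv I1 I0 t γ)
  contMDiffOn_comp : ContMDiffOn (I1.prod I1) I1 ∞ (fun x : X1 × X1 => comp x.1 x.2)
    {x | s x.1 = t x.2}
  s_unit : ∀ x, s (unit x) = x
  t_unit : ∀ x, t (unit x) = x
  s_comp : ∀ γ₂ γ₁, s γ₂ = t γ₁ → s (comp γ₂ γ₁) = s γ₁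
  t_comp : ∀ γ₂ γ₁, s γ₂ = t γ₁ → t (comp γ₂ γ₁) = t γ₂
  comp_assoc : ∀ γ₃ γ₂ γ₁, s γ₃ = t γ₂ → s γ₂ = t γ₁ →
    comp (comp γ₃ γ₂) γ₁ = comp γ₃ (comp γ₂ γ₁)
  comp_unit : ∀ γ, comp γ (unit (s γ)) = γ
  unit_comp : ∀ γ, comp (unit (t γ)) γ = γ
  s_inv : ∀ γ, s (inv γ) = t γ
  t_inv : ∀ γ, t (inv γ) = s γ
  inv_comp : ∀ γ, comp (inv γ) γ = unit (s γ)
  comp_inv : ∀ γ, comp γ (inv γ) = unit (t γ)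

/-- A Lie crossed module `(G, H, τ, α)`. -/
structure LieCrossedModule (IG : ModelWithCorners ℝ EG MG) (IH : ModelWithCorners ℝ EH MH)
    (G H : Type*) [TopologicalSpace G] [ChartedSpace MG G] [Group G]
    [TopologicalSpace H] [ChartedSpace MH H] [Group H] where
  /-- the homomorphism `τ : H → G` -/
  τ : H →* G
  /-- the action of `G` on `H` by automorphisms -/
  α : G →* MulAut H
  contMDiff_τ : ContMDiff IH IG ∞ τ
  contMDiff_α : ContMDiff (IG.prod IH) IH ∞ (fun x : G × H => α x.1 x.2)
  τ_α : ∀ g h, τ (α g h) = g * τ h * g⁻¹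
  α_τ : ∀ h h', α (τ h) h' = h * h' * h⁻¹

namespace LieCrossedModule

variable {IG : ModelWithCorners ℝ EG MG} {IH : ModelWithCorners ℝ EH MH} {G H : Type*}
  [TopologicalSpace G] [ChartedSpace MG G] [Group G]
  [TopologicalSpace H] [ChartedSpace MH H] [Group H]

/-- The Lie group `H ⋊ G` of morphisms of the Lie `2`-group `[H ⋊ G ⇉ G]` of a Lie crossed module;
as a manifold it is the product `H × G`. -/
def Mor (_ : LieCrossedModule IG IH G H) : Type _ := H × G

variable (C : LieCrossedModule IG IH G H)

instance : TopologicalSpace C.Mor := inferInstanceAs (TopologicalSpace (H × G))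

instance : ChartedSpace (ModelProd MH MG) C.Mor :=
  inferInstanceAs (ChartedSpace (ModelProd MH MG) (H × G))

variable {C} in
/-- The `H`-component of an element of `H ⋊ G`. -/
def Mor.hPart (k : C.Mor) : H := k.1

variable {C} in
/-- The `G`-component of an element of `H ⋊ G`, which is also its source in `[H ⋊ G ⇉ G]`. -/
def Mor.src (k : C.Mor) : G := k.2

/-- The element `(h, g)` of `H ⋊ G`. -/
def mor (h : H) (g : G) : C.Mor := (h, g)

variable {C} in
/-- The target `τ(h) g` of a morphism `(h, g)`. -/
def Mor.tgt (k : C.Mor) : G := C.τ k.hPart * k.src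

/-- The identity morphism `(e, g)`. -/
def unit (g : G) : C.Mor := C.mor 1 g

variable {C} in
/-- The composition `(h₂, g₂) ∘ (h₁, g₁) = (h₂ h₁, g₁)`, meaningful for `g₂ = τ(h₁) g₁`. -/
def Mor.comp (k₂ k₁ : C.Mor) : C.Mor := C.mor (k₂.hPart * k₁.hPart) k₁.src

/-- The group structure of the semidirect product: `(h₂, g₂) (h₁, g₁) = (h₂ α(g₂, h₁), g₂ g₁)`. -/
instance : Group C.Mor where
  mul k l := C.mor (k.hPart * C.α k.src l.hPart) (k.src * l.src)
  one := C.mor 1 1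
  inv k := C.mor (C.α k.src⁻¹ k.hPart⁻¹) k.src⁻¹
  mul_assoc a b c := Prod.ext
    (by
      show (a.1 * C.α a.2 b.1) * C.α (a.2 * b.2) c.1 = a.1 * C.α a.2 (b.1 * C.α b.2 c.1)
      simp [mul_assoc])
    (mul_assoc a.2 b.2 c.2)
  one_mul a := Prod.ext (by show 1 * C.α 1 a.1 = a.1; simp) (one_mul a.2)
  mul_one a := Prod.ext (by show a.1 * C.α a.2 1 = a.1; simp) (mul_one a.2)
  inv_mul_cancel a := Prod.ext
    (by show C.α a.2⁻¹ a.1⁻¹ * C.α a.2⁻¹ a.1 = 1; simp) (inv_mul_cancel a.2)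

instance [LieGroup IG ∞ G] [LieGroup IH ∞ H] : LieGroup (IH.prod IG) ∞ C.Mor where
  toIsManifold := inferInstanceAs (IsManifold (IH.prod IG) ∞ (H × G))
  contMDiff_mul := by
    have h1 : ContMDiff ((IH.prod IG).prod (IH.prod IG)) IH ∞
        (fun p : (H × G) × (H × G) => p.1.1 * C.α p.1.2 p.2.1) :=
      (contMDiff_fst.comp contMDiff_fst).mul (C.contMDiff_α.comp
        ((contMDiff_snd.comp contMDiff_fst).prodMk (contMDiff_fst.comp contMDiff_snd)))
    have h2 : ContMDiff ((IH.prod IG).prod (IH.prod IG)) IG ∞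
        (fun p : (H × G) × (H × G) => p.1.2 * p.2.2) :=
      (contMDiff_snd.comp contMDiff_fst).mul (contMDiff_snd.comp contMDiff_snd)
    exact h1.prodMk h2
  contMDiff_inv := by
    have h2 : ContMDiff (IH.prod IG) IG ∞ (fun p : H × G => p.2⁻¹) := contMDiff_snd.inv
    have h1 : ContMDiff (IH.prod IG) IH ∞ (fun p : H × G => C.α p.2⁻¹ p.1⁻¹) :=
      C.contMDiff_α.comp (h2.prodMk contMDiff_fst.inv)
    exact h1.prodMk h2

/-- The splitting `L(H ⋊ G) = L(H) ⊕ L(G)` as a vector space. -/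
def lieSplit : GroupLieAlgebra (IH.prod IG) C.Mor ≃L[ℝ]
    GroupLieAlgebra IH H × GroupLieAlgebra IG G :=
  ContinuousLinearEquiv.refl ℝ (EH × EG)

/-- The differential of `τ` at the identity. -/
def lieτ : GroupLieAlgebra IH H →L[ℝ] GroupLieAlgebra IG G :=
  (mfderiv IH IG C.τ 1 : EH →L[ℝ] EG)

/-- The differential of `α(g) : H → H` at the identity. -/
def lieα (g : G) : GroupLieAlgebra IH H →L[ℝ] GroupLieAlgebra IH H :=
  (mfderiv IH IH (C.α g) 1 : EH →L[ℝ] EH)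

variable {C} in
/-- The source `(A, B) ↦ B` of the Lie groupoid `[L(H) ⊕ L(G) ⇉ L(G)]`. -/
def lieSrc (K : GroupLieAlgebra (IH.prod IG) C.Mor) : GroupLieAlgebra IG G := (C.lieSplit K).2

variable {C} in
/-- The target `(A, B) ↦ τ(A) + B` of the Lie groupoid `[L(H) ⊕ L(G) ⇉ L(G)]`. -/
def lieTgt (K : GroupLieAlgebra (IH.prod IG) C.Mor) : GroupLieAlgebra IG G :=
  C.lieτ (C.lieSplit K).1 + (C.lieSplit K).2

/-- The unit `B ↦ (0, B)` of the Lie groupoid `[L(H) ⊕ L(G) ⇉ L(G)]`. -/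
def lieUnit (B : GroupLieAlgebra IG G) : GroupLieAlgebra (IH.prod IG) C.Mor :=
  C.lieSplit.symm (0, B)

variable {C} in
/-- The composition `(A₂, B₂) ∘ (A₁, B₁) = (A₂ + A₁, B₁)` of `[L(H) ⊕ L(G) ⇉ L(G)]`, meaningful for
`B₂ = τ(A₁) + B₁`. -/
def lieComp (K₂ K₁ : GroupLieAlgebra (IH.prod IG) C.Mor) :
    GroupLieAlgebra (IH.prod IG) C.Mor :=
  C.lieSplit.symm ((C.lieSplit K₂).1 + (C.lieSplit K₁).1, (C.lieSplit K₁).2)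

end LieCrossedModule

end Groupoids

section TwoBundles

variable {E1 M1 E0 M0 EG MG EH MH EP MP EQ MQ : Type*}
  [NormedAddCommGroup E1] [NormedSpace ℝ E1] [TopologicalSpace M1]
  [NormedAddCommGroup E0] [NormedSpace ℝ E0] [TopologicalSpace M0]
  [NormedAddCommGroup EG] [NormedSpace ℝ EG] [TopologicalSpace MG]
  [NormedAddCommGroup EH] [NormedSpace ℝ EH] [TopologicalSpace MH]
  [NormedAddCommGroup EP] [NormedSpace ℝ EP] [TopologicalSpace MP]
  [NormedAddCommGroup EQ] [NormedSpace ℝ EQ] [TopologicalSpace MQ]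
  {I1 : ModelWithCorners ℝ E1 M1} {I0 : ModelWithCorners ℝ E0 M0}
  {X1 X0 : Type*} [TopologicalSpace X1] [ChartedSpace M1 X1]
  [TopologicalSpace X0] [ChartedSpace M0 X0]
  {IG : ModelWithCorners ℝ EG MG} {IH : ModelWithCorners ℝ EH MH} {G H : Type*}
  [TopologicalSpace G] [ChartedSpace MG G] [Group G]
  [TopologicalSpace H] [ChartedSpace MH H] [Group H]

/-- `V = V₂ ∘ V₁` in the tangent groupoid `[TX₁ ⇉ TX₀]`, i.e. `V = m_*(V₂, V₁)` where `m` is the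
composition map on composable pairs: `(V₂, V₁)` is the velocity of a smooth curve `(c₂, c₁)` of
composable pairs, and `V` is the velocity of `c₂ ∘ c₁`. -/
def LieGroupoid.TangentComp (X : LieGroupoid I1 I0 X1 X0) (V₂ V₁ V : TangentBundle I1 X1) : Prop :=
  ∃ c₂ c₁ : ℝ → X1, ContMDiff 𝓘(ℝ, ℝ) I1 ∞ c₂ ∧ ContMDiff 𝓘(ℝ, ℝ) I1 ∞ c₁ ∧
    (∀ r, X.s (c₂ r) = X.t (c₁ r)) ∧ velocity I1 c₂ = V₂ ∧ velocity I1 c₁ = V₁ ∧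
    velocity I1 (fun r => X.comp (c₂ r) (c₁ r)) = V

/-- An `L(𝔾)`-valued `1`-form on a Lie groupoid `[X₁ ⇉ X₀]`: a pair of smooth `1`-forms that
defines a morphism of Lie groupoids `[TX₁ ⇉ TX₀] → [L(H) ⊕ L(G) ⇉ L(G)]`. -/
structure LieGroupoid.IsForm (X : LieGroupoid I1 I0 X1 X0) (C : LieCrossedModule IG IH G H)
    [IsManifold I1 ∞ X1] [IsManifold I0 ∞ X0]
    (θ₁ : LieForm I1 X1 (IH.prod IG) C.Mor) (θ₀ : LieForm I0 X0 IG G) : Prop where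
  smooth₁ : θ₁.IsSmooth
  smooth₀ : θ₀.IsSmooth
  map_src : ∀ γ v, LieCrossedModule.lieSrc (θ₁ γ v) = θ₀ (X.s γ) (mfderiv I1 I0 X.s γ v)
  map_tgt : ∀ γ v, LieCrossedModule.lieTgt (θ₁ γ v) = θ₀ (X.t γ) (mfderiv I1 I0 X.t γ v)
  map_unit : ∀ x v, θ₁ (X.unit x) (mfderiv I0 I1 X.unit x v) = C.lieUnit (θ₀ x v)
  map_comp : ∀ V₂ V₁ V : TangentBundle I1 X1, X.TangentComp V₂ V₁ V →
    θ₁ V.1 V.2 = LieCrossedModule.lieComp (θ₁ V₂.1 V₂.2) (θ₁ V₁.1 V₁.2)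

/-- A principal `𝔾`-bundle `𝔼 = [Q₁ ⇉ Q₀]` over a Lie groupoid `𝕏 = [X₁ ⇉ X₀]`, where
`𝔾 = [H ⋊ G ⇉ G]` is the Lie `2`-group of a Lie crossed module. -/
structure Principal2Bundle (C : LieCrossedModule IG IH G H) (X : LieGroupoid I1 I0 X1 X0)
    (IQ : ModelWithCorners ℝ EQ MQ) (IP : ModelWithCorners ℝ EP MP) (Q P : Type*)
    [TopologicalSpace Q] [ChartedSpace MQ Q] [TopologicalSpace P] [ChartedSpace MP P] where
  /-- the total Lie groupoid -/
  gpd : LieGroupoid IQ IP Q P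
  /-- the bundle of objects -/
  obj : PrincipalBundle IG IP I0 G P X0
  /-- the bundle of morphisms -/
  mor : PrincipalBundle (IH.prod IG) IQ I1 C.Mor Q X1
  -- the projections form a functor
  proj_s : ∀ γ, obj.proj (gpd.s γ) = X.s (mor.proj γ)
  proj_t : ∀ γ, obj.proj (gpd.t γ) = X.t (mor.proj γ)
  proj_unit : ∀ p, mor.proj (gpd.unit p) = X.unit (obj.proj p)
  proj_comp : ∀ γ₂ γ₁, gpd.s γ₂ = gpd.t γ₁ →
    mor.proj (gpd.comp γ₂ γ₁) = X.comp (mor.proj γ₂) (mor.proj γ₁)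
  -- the actions form a functor
  act_s : ∀ γ k, gpd.s (mor.act γ k) = obj.act (gpd.s γ) k.src
  act_t : ∀ γ k, gpd.t (mor.act γ k) = obj.act (gpd.t γ) k.tgt
  act_unit : ∀ p g, mor.act (gpd.unit p) (C.unit g) = gpd.unit (obj.act p g)
  act_comp : ∀ γ₂ γ₁ k₂ k₁, gpd.s γ₂ = gpd.t γ₁ → k₂.src = k₁.tgt →
    mor.act (gpd.comp γ₂ γ₁) (k₂.comp k₁) = gpd.comp (mor.act γ₂ k₂) (mor.act γ₁ k₁)

namespace Principal2Bundle

variable {C : LieCrossedModule IG IH G H} {X : LieGroupoid I1 I0 X1 X0}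
  {IQ : ModelWithCorners ℝ EQ MQ} {IP : ModelWithCorners ℝ EP MP} {Q P : Type*}
  [TopologicalSpace Q] [ChartedSpace MQ Q] [TopologicalSpace P] [ChartedSpace MP P]

/-- A `𝔾`-equivariant `L(𝔾)`-valued `1`-form on the total groupoid of a principal `𝔾`-bundle. -/
structure IsEquivariantForm [IsManifold IQ ∞ Q] [IsManifold IP ∞ P]
    (B : Principal2Bundle C X IQ IP Q P)
    (θ₁ : LieForm IQ Q (IH.prod IG) C.Mor) (θ₀ : LieForm IP P IG G) : Prop where
  isForm : B.gpd.IsForm C θ₁ θ₀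
  equivariant₁ : ∀ γ k v,
    θ₁ (B.mor.act γ k) (B.mor.actDeriv γ k v) = lieAd (IH.prod IG) k⁻¹ (θ₁ γ v)
  equivariant₀ : ∀ p g v, θ₀ (B.obj.act p g) (B.obj.actDeriv p g v) = lieAd IG g⁻¹ (θ₀ p v)

/-- A strict connection `1`-form: an equivariant form `θ` with `θ ∘ δ = pr₂`. -/
structure IsStrictConnection [IsManifold IQ ∞ Q] [IsManifold IP ∞ P]
    (B : Principal2Bundle C X IQ IP Q P)
    (θ₁ : LieForm IQ Q (IH.prod IG) C.Mor) (θ₀ : LieForm IP P IG G) : Prop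
    extends IsEquivariantForm B θ₁ θ₀ where
  vertical₁ : ∀ γ K, θ₁ γ (B.mor.fundamental γ K) = K
  vertical₀ : ∀ p A, θ₀ p (B.obj.fundamental p A) = A

/-- A `𝔾`-equivariant fibrewise linear smooth natural isomorphism `κ : θ ∘ δ ⟹ pr₂` of functors
`𝔼 × L(𝔾) → L(𝔾)`. -/
structure IsVerticalIso (B : Principal2Bundle C X IQ IP Q P)
    (θ₁ : LieForm IQ Q (IH.prod IG) C.Mor) (θ₀ : LieForm IP P IG G)
    (κ : P → GroupLieAlgebra IG G →L[ℝ] GroupLieAlgebra (IH.prod IG) C.Mor) : Prop where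
  smooth : ContMDiff (M' := EH × EG) (IP.prod 𝓘(ℝ, EG)) 𝓘(ℝ, EH × EG) ∞
    (fun x : P × EG => (κ x.1 x.2 : EH × EG))
  src : ∀ p A, LieCrossedModule.lieSrc (κ p A) = θ₀ p (B.obj.fundamental p A)
  tgt : ∀ p A, LieCrossedModule.lieTgt (κ p A) = A
  natural : ∀ γ K, LieCrossedModule.lieComp (κ (B.gpd.t γ) (LieCrossedModule.lieTgt K))
      (θ₁ γ (B.mor.fundamental γ K)) =
    LieCrossedModule.lieComp K (κ (B.gpd.s γ) (LieCrossedModule.lieSrc K))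
  equivariant : ∀ p g A, κ (B.obj.act p g) (lieAd IG g⁻¹ A) =
    lieAd (IH.prod IG) (C.unit g)⁻¹ (κ p A)

/-- A semi-strict connection `1`-form: an equivariant form `θ` such that `θ ∘ δ` and `pr₂` are
related by an equivariant fibrewise linear natural isomorphism. -/
structure IsSemiStrictConnection [IsManifold IQ ∞ Q] [IsManifold IP ∞ P]
    (B : Principal2Bundle C X IQ IP Q P)
    (θ₁ : LieForm IQ Q (IH.prod IG) C.Mor) (θ₀ : LieForm IP P IG G) : Prop
    extends IsEquivariantForm B θ₁ θ₀ where
  exists_iso : ∃ κ, B.IsVerticalIso θ₁ θ₀ κ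

/-- The modification `θ₀ + τ(λ)` of a form on objects by an `L(H)`-valued `1`-form `λ = l`. -/
def modify₀ (C : LieCrossedModule IG IH G H) (θ₀ : LieForm IP P IG G) (l : LieForm IP P IH H) :
    LieForm IP P IG G :=
  fun p => θ₀ p + C.lieτ ∘L l p

/-- The modification `θ₁ + τ(s^*λ) + t^*λ - s^*λ` of a form on morphisms by an `L(H)`-valued
`1`-form `λ = l` on objects; `τ(s^*λ)` is `L(G)`-valued and `t^*λ - s^*λ` is `L(H)`-valued. -/
def modify₁ (B : Principal2Bundle C X IQ IP Q P) (θ₁ : LieForm IQ Q (IH.prod IG) C.Mor)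
    (l : LieForm IP P IH H) : LieForm IQ Q (IH.prod IG) C.Mor :=
  fun γ => θ₁ γ + (C.lieSplit.symm : _ →L[ℝ] GroupLieAlgebra (IH.prod IG) C.Mor) ∘L
    ContinuousLinearMap.prod
      (l (B.gpd.t γ) ∘L mfderiv IQ IP B.gpd.t γ - l (B.gpd.s γ) ∘L mfderiv IQ IP B.gpd.s γ)
      (C.lieτ ∘L l (B.gpd.s γ) ∘L mfderiv IQ IP B.gpd.s γ)

end Principal2Bundle

/-- A principal `G`-bundle `(π : P → X₀, μ, [X₁ ⇉ X₀])` over a Lie groupoid. -/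
structure GroupoidPrincipalBundle (IG : ModelWithCorners ℝ EG MG) (IP : ModelWithCorners ℝ EP MP)
    (G P : Type*) [TopologicalSpace G] [ChartedSpace MG G] [Group G]
    [TopologicalSpace P] [ChartedSpace MP P] (X : LieGroupoid I1 I0 X1 X0)
    extends PrincipalBundle IG IP I0 G P X0 where
  /-- the action map `μ : X₁ ×_{s, X₀, π} P → P` -/
  μ : C^∞⟮I1.prod IG, toPrincipalBundle.Pullback X.s; IP, P⟯
  proj_μ : ∀ z, proj (μ z) = X.t z.fst
  μ_unit : ∀ p h, μ (.mk (X.unit (proj p)) p h) = p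
  μ_comp : ∀ γ₂ γ₁ p h h₁ h₂, X.s γ₂ = X.t γ₁ →
    μ (.mk (X.comp γ₂ γ₁) p h) = μ (.mk γ₂ (μ (.mk γ₁ p h₁)) h₂)
  μ_act : ∀ γ p g h h', act (μ (.mk γ p h)) g = μ (.mk γ (act p g) h')

namespace GroupoidPrincipalBundle

variable {IP : ModelWithCorners ℝ EP MP} {P : Type*}
  [TopologicalSpace P] [ChartedSpace MP P] {X : LieGroupoid I1 I0 X1 X0}

/-- The manifold `s^*P = X₁ ×_{s, X₀, π} P`. -/
abbrev SPull (E : GroupoidPrincipalBundle IG IP G P X) : Type _ := E.toPrincipalBundle.Pullback X.s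

/-- A connection on a principal `G`-bundle over a Lie groupoid: a connection on `P → X₀` with
`s^*θ = t^*θ`, where `s, t : s^*P → P` are `(γ, p) ↦ p` and `(γ, p) ↦ μ(γ, p)`. -/
structure IsConnection [IsManifold IP ∞ P] (E : GroupoidPrincipalBundle IG IP G P X)
    (θ : LieForm IP P IG G) : Prop
    extends E.toPrincipalBundle.IsConnection θ where
  pullback_eq : ∀ (z : E.SPull) (v : TangentSpace (I1.prod IG) z),
    θ z.snd (mfderiv (I1.prod IG) IP (PrincipalBundle.Pullback.snd : E.SPull → P) z v) =
      θ (E.μ z) (mfderiv (I1.prod IG) IP E.μ z v)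

end GroupoidPrincipalBundle

end TwoBundles

section Decorated

variable {E1 M1 E0 M0 EG MG EH MH EP MP : Type*}
  [NormedAddCommGroup E1] [NormedSpace ℝ E1] [TopologicalSpace M1]
  [NormedAddCommGroup E0] [NormedSpace ℝ E0] [TopologicalSpace M0]
  [NormedAddCommGroup EG] [NormedSpace ℝ EG] [TopologicalSpace MG]
  [NormedAddCommGroup EH] [NormedSpace ℝ EH] [TopologicalSpace MH]
  [NormedAddCommGroup EP] [NormedSpace ℝ EP] [TopologicalSpace MP]
  {I1 : ModelWithCorners ℝ E1 M1} {I0 : ModelWithCorners ℝ E0 M0}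
  {X1 X0 : Type*} [TopologicalSpace X1] [ChartedSpace M1 X1]
  [TopologicalSpace X0] [ChartedSpace M0 X0]
  {IG : ModelWithCorners ℝ EG MG} {IH : ModelWithCorners ℝ EH MH} {G H : Type*}
  [TopologicalSpace G] [ChartedSpace MG G] [Group G]
  [TopologicalSpace H] [ChartedSpace MH H] [Group H]
  {IP : ModelWithCorners ℝ EP MP} {P : Type*}
  [TopologicalSpace P] [ChartedSpace MP P] {X : LieGroupoid I1 I0 X1 X0}

set_option linter.unusedSectionVars false

namespace GroupoidPrincipalBundle

open PrincipalBundle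

variable (E : GroupoidPrincipalBundle IG IP G P X) (C : LieCrossedModule IG IH G H)

/-- The target map `(γ, p, h) ↦ μ(γ, p) τ(h⁻¹)` of the decorated groupoid. -/
def decT (z : E.SPull × H) : P := E.act (E.μ z.1) (C.τ z.2⁻¹)

theorem s_eq_t_of_decT {a b : E.SPull × H} (h : a.1.snd = E.decT C b) :
    X.s a.1.fst = X.t b.1.fst := by
  rw [a.1.prop, h, decT, E.proj_act, E.proj_μ]

theorem s_comp_of_decT {a b : E.SPull × H} (h : a.1.snd = E.decT C b) :
    X.s (X.comp a.1.fst b.1.fst) = E.proj b.1.snd := by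
  rw [X.s_comp _ _ (E.s_eq_t_of_decT C h), b.1.prop]

open Classical in
/-- The composition `(γ₂, p₂, h₂) ∘ (γ₁, p₁, h₁) = (γ₂ ∘ γ₁, p₁, h₂ h₁)` of the decorated groupoid
on composable pairs. -/
def decComp (a b : E.SPull × H) : E.SPull × H :=
  if h : a.1.snd = E.decT C b then
    (.mk (X.comp a.1.fst b.1.fst) b.1.snd (E.s_comp_of_decT C h), a.2 * b.2)
  else a

theorem decComp_fst {a b : E.SPull × H} (h : a.1.snd = E.decT C b) :
    (E.decComp C a b).1.fst = X.comp a.1.fst b.1.fst := by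
  rw [decComp, dif_pos h]; rfl

theorem decComp_snd {a b : E.SPull × H} (h : a.1.snd = E.decT C b) :
    (E.decComp C a b).1.snd = b.1.snd := by
  rw [decComp, dif_pos h]; rfl

theorem decComp_H {a b : E.SPull × H} (h : a.1.snd = E.decT C b) :
    (E.decComp C a b).2 = a.2 * b.2 := by
  rw [decComp, dif_pos h]

theorem sPull_ext {a b : E.SPull} (h1 : a.fst = b.fst) (h2 : a.snd = b.snd) : a = b :=
  Subtype.ext (Prod.ext h1 h2)

theorem dec_ext {a b : E.SPull × H} (h1 : a.1.fst = b.1.fst) (h2 : a.1.snd = b.1.snd)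
    (h3 : a.2 = b.2) : a = b :=
  Prod.ext (E.sPull_ext h1 h2) h3

/-- The inverse `(γ, p, h) ↦ (γ⁻¹, μ(γ, p) τ(h⁻¹), h⁻¹)` of the decorated groupoid. -/
def decInv (a : E.SPull × H) : E.SPull × H :=
  (.mk (X.inv a.1.fst) (E.decT C a) (by rw [X.s_inv, decT, E.proj_act, E.proj_μ]), a.2⁻¹)

theorem μ_act' (z : E.SPull) (g : G) : E.act (E.μ z) g =
    E.μ (.mk z.fst (E.act z.snd g) (by rw [E.proj_act]; exact z.prop)) :=
  E.μ_act z.fst z.snd g z.prop _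

theorem decT_decComp {a b : E.SPull × H} (h : a.1.snd = E.decT C b) :
    E.decT C (E.decComp C a b) = E.decT C a := by
  have hst := E.s_eq_t_of_decT C h
  have h1 : X.s (X.comp a.1.fst b.1.fst) = E.proj b.1.snd := E.s_comp_of_decT C h
  have h2 : X.s a.1.fst = E.proj (E.μ (.mk b.1.fst b.1.snd b.1.prop)) := by
    rw [hst, E.proj_μ]; rfl
  rw [decT, decT, E.decComp_H C h]
  have e1 : (E.decComp C a b).1 = .mk (X.comp a.1.fst b.1.fst) b.1.snd h1 :=
    E.sPull_ext (E.decComp_fst C h) (E.decComp_snd C h)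
  rw [e1, E.μ_comp a.1.fst b.1.fst b.1.snd h1 b.1.prop h2 hst, mul_inv_rev, map_mul, E.act_mul,
    E.μ_act']
  congr 2
  exact E.sPull_ext rfl h.symm

theorem decT_decInv (a : E.SPull × H) : E.decT C (E.decInv C a) = a.1.snd := by
  have h1 : X.s (X.inv a.1.fst) = E.proj (E.μ a.1) := by rw [X.s_inv, E.proj_μ]
  have h0 : X.s (X.comp (X.inv a.1.fst) a.1.fst) = E.proj a.1.snd := by
    rw [X.inv_comp, X.s_unit, a.1.prop]
  have e1 : (E.decInv C a).1 = .mk (X.inv a.1.fst) (E.act (E.μ a.1) (C.τ a.2⁻¹))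
      (by rw [E.proj_act]; exact h1) := rfl
  have e2 : (E.decInv C a).2 = a.2⁻¹ := rfl
  rw [decT, e1, e2, ← E.μ_act _ _ _ h1, ← E.act_mul, ← map_mul]
  rw [mul_inv_cancel, map_one, E.act_one]
  have := E.μ_comp (X.inv a.1.fst) a.1.fst a.1.snd h0 a.1.prop h1 (X.s_inv _)
  refine Eq.trans this.symm ?_
  have e3 : (.mk (X.comp (X.inv a.1.fst) a.1.fst) a.1.snd h0 : E.SPull) =
      .mk (X.unit (E.proj a.1.snd)) a.1.snd (X.s_unit _) := by
    refine E.sPull_ext ?_ rfl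
    show X.comp (X.inv a.1.fst) a.1.fst = X.unit (E.proj a.1.snd)
    rw [X.inv_comp, a.1.prop]
  rw [e3, E.μ_unit]

variable [IsManifold I1 ∞ X1] [LieGroup IG ∞ G] [LieGroup IH ∞ H]

theorem contMDiff_decT : ContMDiff ((I1.prod IG).prod IH) IP ∞ (E.decT C) :=
  E.contMDiff_act.comp ((E.μ.contMDiff.comp contMDiff_fst).prodMk
    (C.contMDiff_τ.comp contMDiff_snd.inv))

theorem contMDiff_decInv :
    ContMDiff ((I1.prod IG).prod IH) ((I1.prod IG).prod IH) ∞ (E.decInv C) :=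
  (Pullback.contMDiff_of_comp
    (X.inv.contMDiff.comp (Pullback.contMDiff_fst.comp contMDiff_fst)) (E.contMDiff_decT C)).prodMk
    contMDiff_snd.inv

theorem decInv_decInv (a : E.SPull × H) : E.decInv C (E.decInv C a) = a := by
  refine E.dec_ext ?_ (E.decT_decInv C a) (inv_inv a.2)
  show X.inv (X.inv a.1.fst) = a.1.fst
  generalize a.1.fst = γ
  have h1 := X.inv_comp (X.inv γ)
  have h2 := X.comp_assoc (X.inv (X.inv γ)) (X.inv γ) γ (X.s_inv _) (X.s_inv _)
  rw [h1, X.inv_comp, X.s_inv, X.unit_comp] at h2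
  have h3 := X.comp_unit (X.inv (X.inv γ))
  rw [X.s_inv, X.t_inv] at h3
  exact h3.symm.trans h2.symm

theorem surjective_mfderiv_decS (a : E.SPull × H) : Function.Surjective
    (mfderiv ((I1.prod IG).prod IH) IP (fun z : E.SPull × H => z.1.snd) a) := by
  have h : mfderiv ((I1.prod IG).prod IH) IP (fun z : E.SPull × H => z.1.snd) a =
      (mfderiv (I1.prod IG) IP (Pullback.snd : E.SPull → P) a.1) ∘L
        (ContinuousLinearMap.fst ℝ (TangentSpace (I1.prod IG) a.1) (TangentSpace IH a.2)) := by
    have := mfderiv_comp a (g := (Pullback.snd : E.SPull → P)) (f := (Prod.fst : E.SPull × H → _))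
      (Pullback.contMDiff_snd.mdifferentiableAt (by simp))
      (mdifferentiableAt_fst (I := I1.prod IG) (I' := IH))
    rw [mfderiv_fst] at this
    exact this
  rw [h]
  exact (Pullback.surjective_mfderiv_snd a.1 (X.s_submersion _)).comp
    (fun v => ⟨(v, 0), rfl⟩)

theorem surjective_mfderiv_decT (a : E.SPull × H) : Function.Surjective
    (mfderiv ((I1.prod IG).prod IH) IP (E.decT C) a) := by
  have hS : ContMDiff ((I1.prod IG).prod IH) IP ∞ (fun z : E.SPull × H => z.1.snd) :=
    Pullback.contMDiff_snd.comp contMDiff_fst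
  have hi : ∀ b, MDifferentiableAt ((I1.prod IG).prod IH) ((I1.prod IG).prod IH) (E.decInv C) b :=
    (E.contMDiff_decInv C).mdifferentiable (by simp)
  have h1 : E.decT C = (fun z : E.SPull × H => z.1.snd) ∘ E.decInv C := rfl
  rw [h1, mfderiv_comp a (hS.mdifferentiableAt (by simp)) (hi a)]
  refine (E.surjective_mfderiv_decS (E.decInv C a)).comp ?_
  have h2 : E.decInv C ∘ E.decInv C = id := funext (E.decInv_decInv C)
  have h3 := mfderiv_comp (E.decInv C a) (hi (E.decInv C (E.decInv C a))) (hi (E.decInv C a))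
  rw [h2, mfderiv_id] at h3
  intro v
  have h4 := congrArg (fun T => T v) h3
  have h5 := E.decInv_decInv C a
  generalize hw : (mfderiv ((I1.prod IG).prod IH) ((I1.prod IG).prod IH) (E.decInv C)
    (E.decInv C a) v : (E1 × EG) × EH) = w
  refine ⟨w, ?_⟩
  have h6 : mfderiv ((I1.prod IG).prod IH) ((I1.prod IG).prod IH) (E.decInv C)
      (E.decInv C (E.decInv C a)) w = (v : (E1 × EG) × EH) := by
    rw [← hw]; exact h4.symm
  rw [h5] at h6
  exact h6

/-- The decorated Lie groupoid `[s^*P × H ⇉ P]`. -/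
def decGroupoid : LieGroupoid ((I1.prod IG).prod IH) IP (E.SPull × H) P where
  s := ⟨fun z => z.1.snd, Pullback.contMDiff_snd.comp contMDiff_fst⟩
  t := ⟨E.decT C, E.contMDiff_decT C⟩
  unit := ⟨fun p => (.mk (X.unit (E.proj p)) p (X.s_unit _), 1),
    (Pullback.contMDiff_of_comp (X.unit.contMDiff.comp E.proj.contMDiff) contMDiff_id).prodMk
      contMDiff_const⟩
  inv := ⟨E.decInv C, E.contMDiff_decInv C⟩
  comp := E.decComp C
  s_submersion := E.surjective_mfderiv_decS
  t_submersion := E.surjective_mfderiv_decT C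
  contMDiffOn_comp := by
    have hp1 : ContMDiff (((I1.prod IG).prod IH).prod ((I1.prod IG).prod IH)) (I1.prod IG) ∞
        (fun x : (E.SPull × H) × (E.SPull × H) => x.1.1) := contMDiff_fst.comp contMDiff_fst
    have hp2 : ContMDiff (((I1.prod IG).prod IH).prod ((I1.prod IG).prod IH)) (I1.prod IG) ∞
        (fun x : (E.SPull × H) × (E.SPull × H) => x.2.1) := contMDiff_fst.comp contMDiff_snd
    have key : ContMDiffOn (((I1.prod IG).prod IH).prod ((I1.prod IG).prod IH))
        ((I1.prod IG).prod IH) ∞ (fun x : (E.SPull × H) × (E.SPull × H) =>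
          ((E.decComp C x.1 x.2).1, x.1.2 * x.2.2)) {x | x.1.1.snd = E.decT C x.2} := by
      refine ContMDiffOn.prodMk ?_ ?_
      · intro x hx
        refine Pullback.contMDiffWithinAt_of_comp ?_ ?_
        · have h := X.contMDiffOn_comp.comp
            (((Pullback.contMDiff_fst.comp hp1).prodMk
              (Pullback.contMDiff_fst.comp hp2)).contMDiffOn
              (s := {x : (E.SPull × H) × (E.SPull × H) | x.1.1.snd = E.decT C x.2}))
            (fun y hy => E.s_eq_t_of_decT C hy)
          exact (h x hx).congr (fun y hy => E.decComp_fst C hy) (E.decComp_fst C hx)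
        · exact ((Pullback.contMDiff_snd.comp hp2).contMDiffOn x hx).congr
            (fun y hy => E.decComp_snd C hy) (E.decComp_snd C hx)
      · exact ((contMDiff_snd.comp contMDiff_fst).mul
          (contMDiff_snd.comp contMDiff_snd)).contMDiffOn
    exact key.congr (fun x hx => Prod.ext rfl (E.decComp_H C hx))
  s_unit p := rfl
  t_unit p := by
    show E.act (E.μ (.mk (X.unit (E.proj p)) p (X.s_unit _))) (C.τ 1⁻¹) = p
    rw [inv_one, map_one, E.act_one, E.μ_unit]
  s_comp a b h := E.decComp_snd C h
  t_comp a b h := E.decT_decComp C h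
  comp_assoc a b c hab hbc := by
    have hab' : a.1.snd = E.decT C b := hab
    have hbc' : b.1.snd = E.decT C c := hbc
    have h1 : (E.decComp C a b).1.snd = E.decT C c := (E.decComp_snd C hab').trans hbc
    have h2 : a.1.snd = E.decT C (E.decComp C b c) := by rw [E.decT_decComp C hbc']; exact hab
    refine E.dec_ext ?_ ?_ ?_
    · rw [E.decComp_fst C h1, E.decComp_fst C h2, E.decComp_fst C hab', E.decComp_fst C hbc',
        X.comp_assoc _ _ _ (E.s_eq_t_of_decT C hab') (E.s_eq_t_of_decT C hbc')]
    · rw [E.decComp_snd C h1, E.decComp_snd C h2, E.decComp_snd C hbc']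
    · rw [E.decComp_H C h1, E.decComp_H C h2, E.decComp_H C hab', E.decComp_H C hbc', mul_assoc]
  comp_unit a := by
    have h : a.1.snd = E.decT C (.mk (X.unit (E.proj a.1.snd)) a.1.snd (X.s_unit _), 1) := by
      show _ = E.act (E.μ _) (C.τ 1⁻¹)
      rw [inv_one, map_one, E.act_one, E.μ_unit]
    refine E.dec_ext ((E.decComp_fst C h).trans ?_) ((E.decComp_snd C h).trans rfl)
      ((E.decComp_H C h).trans (mul_one _))
    show X.comp a.1.fst (X.unit (E.proj a.1.snd)) = a.1.fst
    rw [← a.1.prop, X.comp_unit]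
  unit_comp a := by
    have h : (((.mk (X.unit (E.proj (E.decT C a))) (E.decT C a) (X.s_unit _), 1) :
      E.SPull × H)).1.snd = E.decT C a := rfl
    refine E.dec_ext ((E.decComp_fst C h).trans ?_) ((E.decComp_snd C h).trans rfl)
      ((E.decComp_H C h).trans (one_mul _))
    show X.comp (X.unit (E.proj (E.decT C a))) a.1.fst = a.1.fst
    rw [decT, E.proj_act, E.proj_μ, X.unit_comp]
  s_inv a := rfl
  t_inv a := E.decT_decInv C a
  inv_comp a := by
    have h : (E.decInv C a).1.snd = E.decT C a := rfl
    refine E.dec_ext ((E.decComp_fst C h).trans ?_) ((E.decComp_snd C h).trans rfl)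
      ((E.decComp_H C h).trans (inv_mul_cancel a.2))
    show X.comp (X.inv a.1.fst) a.1.fst = X.unit (E.proj a.1.snd)
    rw [X.inv_comp, a.1.prop]
  comp_inv a := by
    have h : a.1.snd = E.decT C (E.decInv C a) := (E.decT_decInv C a).symm
    refine E.dec_ext ((E.decComp_fst C h).trans ?_) ((E.decComp_snd C h).trans rfl)
      ((E.decComp_H C h).trans (mul_inv_cancel a.2))
    show X.comp a.1.fst (X.inv a.1.fst) = X.unit (E.proj (E.decT C a))
    rw [X.comp_inv, decT, E.proj_act, E.proj_μ]

/-- The action `(γ, p, h) (h', g) = (γ, p g, α(g⁻¹, h'⁻¹ h))` of `H ⋊ G` on `s^*P × H`. -/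
def decAct (z : E.SPull × H) (k : C.Mor) : E.SPull × H :=
  (.mk z.1.fst (E.act z.1.snd k.src) (by rw [E.proj_act]; exact z.1.prop),
    C.α k.src⁻¹ (k.hPart⁻¹ * z.2))

/-- The rearrangement `((γ, g), h) ↦ (γ, (α(g, h⁻¹), g))`. -/
def decRearrange : (X1 × G) × H ≃ₜ X1 × C.Mor where
  toFun x := (x.1.1, C.mor (C.α x.1.2 x.2⁻¹) x.1.2)
  invFun y := ((y.1, y.2.src), (C.α y.2.src⁻¹ y.2.hPart)⁻¹)
  left_inv x := Prod.ext rfl (by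
    show (C.α x.1.2⁻¹ (C.α x.1.2 x.2⁻¹))⁻¹ = x.2
    simp)
  right_inv y := Prod.ext rfl (Prod.ext (by
    show C.α y.2.2 ((C.α y.2.2⁻¹ y.2.1)⁻¹)⁻¹ = y.2.1
    simp) rfl)
  continuous_toFun := by
    have := topologicalGroup_of_lieGroup IH ∞ (G := H)
    exact (continuous_fst.comp continuous_fst).prodMk ((C.contMDiff_α.continuous.comp
      ((continuous_snd.comp continuous_fst).prodMk continuous_snd.inv)).prodMk
      (continuous_snd.comp continuous_fst))
  continuous_invFun := by
    have := topologicalGroup_of_lieGroup IH ∞ (G := H)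
    have := topologicalGroup_of_lieGroup IG ∞ (G := G)
    have h1 : Continuous (fun y : X1 × (H × G) => y.2.2) := continuous_snd.comp continuous_snd
    have h2 : Continuous (fun y : X1 × (H × G) => y.2.1) := continuous_fst.comp continuous_snd
    exact (continuous_fst.prodMk h1).prodMk (C.contMDiff_α.continuous.comp (h1.inv.prodMk h2)).inv

theorem contMDiff_decRearrange : ContMDiff ((I1.prod IG).prod IH) (I1.prod (IH.prod IG)) ∞
    (decRearrange C : (X1 × G) × H ≃ₜ X1 × C.Mor) := by
  have h : ContMDiff ((I1.prod IG).prod IH) (I1.prod (IH.prod IG)) ∞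
      (fun x : (X1 × G) × H => (x.1.1, (C.α x.1.2 x.2⁻¹, x.1.2))) :=
    (contMDiff_fst.comp contMDiff_fst).prodMk ((C.contMDiff_α.comp
      ((contMDiff_snd.comp contMDiff_fst).prodMk contMDiff_snd.inv)).prodMk
      (contMDiff_snd.comp contMDiff_fst))
  exact h

theorem contMDiff_decRearrange_symm : ContMDiff (I1.prod (IH.prod IG)) ((I1.prod IG).prod IH) ∞
    (decRearrange C : (X1 × G) × H ≃ₜ X1 × C.Mor).symm := by
  have h1 : ContMDiff (I1.prod (IH.prod IG)) IG ∞ (fun y : X1 × (H × G) => y.2.2) :=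
    contMDiff_snd.comp contMDiff_snd
  have h2 : ContMDiff (I1.prod (IH.prod IG)) IH ∞ (fun y : X1 × (H × G) => y.2.1) :=
    contMDiff_fst.comp contMDiff_snd
  have h : ContMDiff (I1.prod (IH.prod IG)) ((I1.prod IG).prod IH) ∞
      (fun y : X1 × (H × G) => ((y.1, y.2.2), (C.α y.2.2⁻¹ y.2.1)⁻¹)) :=
    (contMDiff_fst.prodMk h1).prodMk (C.contMDiff_α.comp (h1.inv.prodMk h2)).inv
  exact h

/-- The local trivialization `(γ, p, h) ↦ (γ, (α(g, h⁻¹), g))` of `s^*P × H → X₁`, where `g` is the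
`G`-coordinate of `p` in a local trivialization of `P`. -/
def decTriv (x : X0) (z₀ : E.SPull) :
    Bundle.Trivialization C.Mor (fun z : E.SPull × H => z.1.fst) where
  toOpenPartialHomeomorph :=
    ((Pullback.trivChart E.toPrincipalBundle X.s (E.triv x) z₀).prod
      (OpenPartialHomeomorph.refl H)).transHomeomorph (decRearrange C)
  baseSet := X.s ⁻¹' (E.triv x).baseSet
  open_baseSet := (E.triv x).open_baseSet.preimage X.s.contMDiff.continuous
  source_eq := by
    ext z
    show (X.s z.1.fst ∈ (E.triv x).baseSet ∧ True) ↔ _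
    simp
  target_eq := by
    ext y
    show (X.s y.1 ∈ (E.triv x).baseSet ∧ True) ↔ _
    simp
  proj_toFun z _ := rfl

/-- The decorated principal `𝔾`-bundle `𝔼^dec = [s^*P × H ⇉ P]` over `[X₁ ⇉ X₀]`. -/
def decorated : Principal2Bundle C X ((I1.prod IG).prod IH) IP (E.SPull × H) P where
  gpd := E.decGroupoid C
  obj := E.toPrincipalBundle
  mor :=
    { proj := ⟨fun z => z.1.fst, Pullback.contMDiff_fst.comp contMDiff_fst⟩
      act := E.decAct C
      contMDiff_act := by
        have h1 : ContMDiff (((I1.prod IG).prod IH).prod (IH.prod IG)) (I1.prod IG) ∞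
          (fun x : (E.SPull × H) × (H × G) => x.1.1) := contMDiff_fst.comp contMDiff_fst
        have h2 : ContMDiff (((I1.prod IG).prod IH).prod (IH.prod IG)) IG ∞
          (fun x : (E.SPull × H) × (H × G) => x.2.2) := contMDiff_snd.comp contMDiff_snd
        have h3 : ContMDiff (((I1.prod IG).prod IH).prod (IH.prod IG)) IH ∞
          (fun x : (E.SPull × H) × (H × G) => C.α x.2.2⁻¹ (x.2.1⁻¹ * x.1.2)) :=
          C.contMDiff_α.comp (h2.inv.prodMk ((contMDiff_fst.comp contMDiff_snd).inv.mul
            (contMDiff_snd.comp contMDiff_fst)))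
        have h6 : ContMDiff (((I1.prod IG).prod IH).prod (IH.prod IG)) I1 ∞
          (fun x : (E.SPull × H) × (H × G) => x.1.1.fst) := Pullback.contMDiff_fst.comp h1
        have h5 : ContMDiff (((I1.prod IG).prod IH).prod (IH.prod IG)) IP ∞
          (fun x : (E.SPull × H) × (H × G) => E.act x.1.1.snd x.2.2) :=
          E.contMDiff_act.comp ((Pullback.contMDiff_snd.comp h1).prodMk h2)
        have h4 : ContMDiff (((I1.prod IG).prod IH).prod (IH.prod IG)) ((I1.prod IG).prod IH) ∞
          (fun x : (E.SPull × H) × (H × G) => E.decAct C x.1 x.2) :=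
          (Pullback.contMDiff_of_comp
            (F := fun x : (E.SPull × H) × (H × G) => (E.decAct C x.1 x.2).1)
            h6 h5).prodMk h3
        exact h4
      act_one := fun z => E.dec_ext rfl (E.act_one _) (by
        show C.α 1⁻¹ (1⁻¹ * z.2) = z.2
        simp)
      act_mul := fun z k l => E.dec_ext rfl (E.act_mul _ _ _) (by
        show C.α (k.2 * l.2)⁻¹ ((k.1 * C.α k.2 l.1)⁻¹ * z.2) =
          C.α l.2⁻¹ (l.1⁻¹ * C.α k.2⁻¹ (k.1⁻¹ * z.2))
        simp [mul_assoc])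
      proj_act := fun z k => rfl
      locally_trivial := by
        intro γ
        have hx : X.s γ ∈ (E.triv (X.s γ)).baseSet := E.mem_triv _
        let z₀ : E.SPull := .mk γ
          ((E.triv (X.s γ)).toOpenPartialHomeomorph.symm (X.s γ, 1))
          ((E.triv (X.s γ)).proj_symm_apply' hx).symm
        obtain ⟨-, -, -, hequiv⟩ := (E.locally_trivial (X.s γ)).choose_spec
        change ∀ p ∈ (E.triv (X.s γ)).source, ∀ g, ((E.triv (X.s γ)) (E.act p g)).2 =
          ((E.triv (X.s γ)) p).2 * g at hequiv
        refine ⟨E.decTriv C (X.s γ) z₀, hx, ?_, ?_, ?_⟩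
        · have h := Pullback.contMDiffOn_trivChart (IN := I1) (IG := IG) (X.s γ) z₀
          exact (contMDiff_decRearrange C).comp_contMDiffOn
            ((h.comp (contMDiff_fst (I := I1.prod IG) (J := IH)).contMDiffOn
              (fun z hz => hz.1)).prodMk contMDiffOn_snd)
        · have h := Pullback.contMDiffOn_trivChart_symm (IN := I1) (IG := IG) (X.s γ) z₀
          have h' : ContMDiffOn ((I1.prod IG).prod IH) ((I1.prod IG).prod IH) ∞
              (fun y : (X1 × G) × H => ((Pullback.trivChart E.toPrincipalBundle X.s
                (E.triv (X.s γ)) z₀).symm y.1, y.2))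
              {y | X.s y.1.1 ∈ (E.triv (X.s γ)).baseSet} :=
            (h.comp (contMDiff_fst (I := I1.prod IG) (J := IH)).contMDiffOn
              (fun z hz => hz)).prodMk contMDiffOn_snd
          exact h'.comp (contMDiff_decRearrange_symm C).contMDiffOn (fun y hy => hy.1)
        · intro z hz k
          have hz' : z.1.snd ∈ (E.triv (X.s γ)).source := by
            rw [Bundle.Trivialization.mem_source, ← z.1.prop]
            exact hz.1
          have h := hequiv z.1.snd hz' k.src
          refine Prod.ext ?_ h
          show C.α ((E.triv (X.s γ)) (E.act z.1.snd k.src)).2 (C.α k.2⁻¹ (k.1⁻¹ * z.2))⁻¹ =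
            C.α ((E.triv (X.s γ)) z.1.snd).2 z.2⁻¹ * C.α ((E.triv (X.s γ)) z.1.snd).2 k.1
          rw [h]
          simp [LieCrossedModule.Mor.src] }
  proj_s z := z.1.prop.symm
  proj_t z := by
    show E.proj (E.act (E.μ z.1) _) = X.t z.1.fst
    rw [E.proj_act, E.proj_μ]
  proj_unit p := rfl
  proj_comp a b h := E.decComp_fst C h
  act_s z k := rfl
  act_t z k := by
    show E.act (E.μ _) (C.τ (C.α k.2⁻¹ (k.1⁻¹ * z.2))⁻¹) =
      E.act (E.act (E.μ z.1) (C.τ z.2⁻¹)) (C.τ k.1 * k.2)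
    have : E.μ (E.decAct C z k).1 = E.act (E.μ z.1) k.2 := (E.μ_act' z.1 k.2).symm
    refine (congrArg (fun p => E.act p _) this).trans ?_
    rw [← E.act_mul, ← E.act_mul]
    congr 1
    rw [map_inv, C.τ_α]
    simp [mul_assoc]
  act_unit p g := by
    refine E.dec_ext ?_ rfl ?_
    · show X.unit (E.proj p) = X.unit (E.proj (E.act p g))
      rw [E.proj_act]
    · show C.α g⁻¹ (1⁻¹ * 1) = 1
      simp
  act_comp a b k l hab hkl := by
    have hab' : a.1.snd = E.decT C b := hab
    have hkl' : k.2 = C.τ l.1 * l.2 := hkl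
    have ht : E.decT C (E.decAct C b l) = E.act (E.decT C b) (C.τ l.1 * l.2) := by
      show E.act (E.μ _) (C.τ (C.α l.2⁻¹ (l.1⁻¹ * b.2))⁻¹) =
        E.act (E.act (E.μ b.1) (C.τ b.2⁻¹)) (C.τ l.1 * l.2)
      have : E.μ (E.decAct C b l).1 = E.act (E.μ b.1) l.2 := (E.μ_act' b.1 l.2).symm
      refine (congrArg (fun p => E.act p _) this).trans ?_
      rw [← E.act_mul, ← E.act_mul]
      congr 1
      rw [map_inv, C.τ_α]
      simp [mul_assoc]
    have h2 : (E.decAct C a k).1.snd = E.decT C (E.decAct C b l) := by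
      rw [ht, ← hab', ← hkl']; rfl
    refine E.dec_ext ?_ ?_ ?_
    · refine (E.decComp_fst C hab').trans (E.decComp_fst C h2).symm
    · refine Eq.trans ?_ (E.decComp_snd C h2).symm
      show E.act (E.decComp C a b).1.snd l.2 = E.act b.1.snd l.2
      rw [E.decComp_snd C hab']
    · refine Eq.trans ?_ (E.decComp_H C h2).symm
      show C.α l.2⁻¹ ((k.1 * l.1)⁻¹ * (E.decComp C a b).2) =
        C.α k.2⁻¹ (k.1⁻¹ * a.2) * C.α l.2⁻¹ (l.1⁻¹ * b.2)
      rw [E.decComp_H C hab', hkl', mul_inv_rev (C.τ _), ← map_inv C.τ, map_mul C.α,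
        MulAut.mul_apply, C.α_τ, ← map_mul]
      congr 1
      group

/-- The form `θ^dec_{(γ, p, h)}(X, v, K) = Ad_{(h, e)}(θ_p(v)) - K · h⁻¹` on `s^*P × H`, with values
in `L(H ⋊ G) = L(H) ⊕ L(G)`. -/
def decForm (θ : LieForm IP P IG G) :
    LieForm ((I1.prod IG).prod IH) (E.SPull × H) (IH.prod IG) C.Mor :=
  fun z =>
    lieAd (IH.prod IG) (C.mor z.2 1) ∘L
        (C.lieSplit.symm : _ →L[ℝ] GroupLieAlgebra (IH.prod IG) C.Mor) ∘L
        ContinuousLinearMap.inr ℝ (GroupLieAlgebra IH H) (GroupLieAlgebra IG G) ∘L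
        θ z.1.snd ∘L
        mfderiv ((I1.prod IG).prod IH) IP (fun w : E.SPull × H => w.1.snd) z -
      (C.lieSplit.symm : _ →L[ℝ] GroupLieAlgebra (IH.prod IG) C.Mor) ∘L
        ContinuousLinearMap.inl ℝ (GroupLieAlgebra IH H) (GroupLieAlgebra IG G) ∘L
        rightTranslateToOne IH z.2 ∘L
        mfderiv ((I1.prod IG).prod IH) IH (fun w : E.SPull × H => w.2) z

end GroupoidPrincipalBundle

end Decorated

end

/-! Every structure map of the Lie 2-algebra is the differential of a group homomorphism, so the
identities between forms reduce to product rules and conjugation identities in `H ⋊ G`. Three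
homomorphisms into `H ⋊ G` are used: `inH h = (h, 1)`, whose image is the kernel of the source; `inG
g = (1, g)`, the units; and `tgtKer h = (h⁻¹, τ h)`, whose image is the kernel of the target.
Conjugation by `k` acts on `inH` through `α` at the target of `k` and on `tgtKer` through `α` at the
source of `k` (`conj_inH`, `conj_tgtKer`). On Lie algebras `tgtKer` becomes `inG ∘ τ - inH`, and
composition becomes `K₂ + K₁ - inG (src K₂)` (`lieComp_eq`).

With `MC` the right Maurer–Cartan form, the decorated form at `(γ, p, h)` is `Ad_{inH h} (inG (ω v))
- inH (MC K)`. Its source is `ω v`. Its target is `Ad_{τ h} (ω v) - τ (MC K)`, which is `ω` on the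
derivative of `μ(γ, p) τ(h⁻¹)`: this is the transformation rule of a connection under a varying
group element (`IsConnection.eval_act`), and it is here that the two pullbacks of `ω` to `s^*E₀`
must agree. For compositions, the cocycle rule `MC(h₂ h₁) = MC(h₂) + Ad_{h₂} MC(h₁)` gives `Ad_{inH
h₂} K₁ - inH (MC(h₂))` as the value on the composite, where `K₁` is the value on the first factor.
Now `K₁ - inG (tgt K₁)` lies in the image of `tgtKer`, which `inH h₂` fixes because its source is
`1` (`lieAd_inH_sub`), and what remains is the composition law.

Equivariance and verticality both come from one identity in `H ⋊ G`: the `H`-coordinate `h'` of `(γ,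
p, h) k` satisfies `inH h' = k⁻¹ · inH h · inG (src k)` (`inH_decAct`). Differentiating with `k`
fixed gives equivariance; differentiating in `k` at the identity gives verticality.

The semi-strict statement holds for any strict connection on any principal 2-bundle. The correction
to `ω₁` is `inH (t^*λ) + tgtKer (s^*λ)`. The first term is invisible to the source and the second to
the target, so each structure map sees one copy of `τ(λ)`, and the two conjugation rules match the
equivariance of `t` and `s`. The arrow `κ_p(A) = inG A + tgtKer (λ(δ_p A))` runs from `A + τ(λ(δ_p
A))` to `A` and is the required natural isomorphism. -/

noncomputable section

/-! ### Tangent maps on bundled vectors, partial differentials and their smoothness -/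

section TangentMaps

variable {EM MM EN MN EK MK EQ MQ : Type*}
  [NormedAddCommGroup EM] [NormedSpace ℝ EM] [TopologicalSpace MM]
  [NormedAddCommGroup EN] [NormedSpace ℝ EN] [TopologicalSpace MN]
  [NormedAddCommGroup EK] [NormedSpace ℝ EK] [TopologicalSpace MK]
  [NormedAddCommGroup EQ] [NormedSpace ℝ EQ] [TopologicalSpace MQ]
  {IM : ModelWithCorners ℝ EM MM} {IN : ModelWithCorners ℝ EN MN}
  {IK : ModelWithCorners ℝ EK MK} {IQ : ModelWithCorners ℝ EQ MQ}
  {M N K Q : Type*} [TopologicalSpace M] [ChartedSpace MM M]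
  [TopologicalSpace N] [ChartedSpace MN N] [TopologicalSpace K] [ChartedSpace MK K]
  [TopologicalSpace Q] [ChartedSpace MQ Q]

/-- The fibre coordinate of a tangent vector, in the model vector space. -/
def fiberCoord (V : TangentBundle IM M) : EM := V.2

theorem tangentMap_comp_apply {g : N → K} {f : M → N} {V : TangentBundle IM M}
    (hg : MDifferentiableAt IN IK g (f V.1)) (hf : MDifferentiableAt IM IN f V.1) :
    tangentMap IM IK (fun x => g (f x)) V = tangentMap IN IK g (tangentMap IM IN f V) :=
  tangentMap_comp_at V hg hf

theorem tangentMap_const_snd (c : N) (V : TangentBundle IM M) :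
    tangentMap IM IN (fun _ => c) V = ⟨c, 0⟩ := by
  rw [tangentMap, mfderiv_const]
  rfl

/-- The differential of `q ↦ F (f q, g q)` is the sum of its partial differentials. -/
theorem mfderiv_comp_prod_apply {F : M × N → K} {f : Q → M} {g : Q → N} {q : Q}
    (hF : MDifferentiableAt (IM.prod IN) IK F (f q, g q)) (hf : MDifferentiableAt IQ IM f q)
    (hg : MDifferentiableAt IQ IN g q) (v : TangentSpace IQ q) :
    mfderiv IQ IK (fun x => F (f x, g x)) q v =
      mfderiv IM IK (fun x => F (x, g q)) (f q) (mfderiv IQ IM f q v) +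
      mfderiv IN IK (fun y => F (f q, y)) (g q) (mfderiv IQ IN g q v) := by
  have h1 := mfderiv_comp_apply q (g := F) (f := fun x => (f x, g x)) hF (hf.prodMk hg) v
  have h2 := mfderiv_prod_eq_add_apply (v := mfderiv IQ (IM.prod IN) (fun x => (f x, g x)) q v) hF
  rw [mfderiv_prodMk hf hg] at h1 h2
  exact h1.trans h2

theorem contMDiff_tangentMap_infty [IsManifold IM ∞ M] [IsManifold IN ∞ N] {f : M → N}
    (hf : ContMDiff IM IN ∞ f) :
    ContMDiff IM.tangent IN.tangent ∞ (tangentMap IM IN f) :=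
  hf.contMDiff_tangentMap le_rfl

theorem contMDiff_tangent_zero [IsManifold IM ∞ M] :
    ContMDiff IM IM.tangent ∞ (fun x : M => (⟨x, 0⟩ : TangentBundle IM M)) :=
  Bundle.contMDiff_zeroSection ℝ (TangentSpace IM : M → Type _)

/-- The coordinate change from the preferred chart at a point to itself is the identity over that
point. -/
theorem trivializationAt_tangent_self [IsManifold IM 1 M] (V : TangentBundle IM M) :
    (trivializationAt EM (TangentSpace IM : M → Type _) V.1 V).2 = (V.2 : EM) :=
  (tangentBundleCore IM M).coordChange_self (achart MM V.1) V.1 (mem_chart_source MM V.1) V.2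

/-- The inclusion of a tangent space into the tangent bundle is smooth. -/
theorem contMDiff_tangent_fiber [IsManifold IM ∞ M] (x : M) :
    ContMDiff 𝓘(ℝ, EM) IM.tangent ∞ (fun v : EM => (⟨x, v⟩ : TangentBundle IM M)) := by
  intro v
  rw [Bundle.contMDiffAt_totalSpace]
  refine ⟨contMDiffAt_const, ?_⟩
  have h : (fun w : EM => (trivializationAt EM (TangentSpace IM : M → Type _) x
      (⟨x, w⟩ : TangentBundle IM M)).2) = id := by
    funext w
    exact trivializationAt_tangent_self (⟨x, w⟩ : TangentBundle IM M)
  exact h ▸ contMDiffAt_id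

/-- The fibre coordinate of a smooth family of tangent vectors at one point is smooth. -/
theorem contMDiff_snd_of_tangent [IsManifold IM ∞ M] (x : M)
    {f : Q → TangentBundle IM M} (hf : ContMDiff IQ IM.tangent ∞ f) (hx : ∀ q, (f q).1 = x) :
    ContMDiff IQ 𝓘(ℝ, EM) ∞ (fun q => fiberCoord (f q)) := by
  intro q
  have h := (Bundle.contMDiffAt_totalSpace.1 (hf q)).2
  refine h.congr_of_eventuallyEq (Filter.Eventually.of_forall fun r => ?_)
  -- All base points are `x`, so the trivialization chosen at `q` is also the one centred at the
  -- base point of `f r`, where it is the identity on fibres.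
  rw [hx q, ← hx r]
  exact (trivializationAt_tangent_self (f r)).symm

/-- Pairs of tangent vectors are tangent vectors of the product, smoothly. -/
theorem contMDiff_tangent_prodMk [IsManifold IM ∞ M] [IsManifold IN ∞ N]
    {f : Q → TangentBundle IM M} {g : Q → TangentBundle IN N}
    (hf : ContMDiff IQ IM.tangent ∞ f) (hg : ContMDiff IQ IN.tangent ∞ g) :
    ContMDiff IQ (IM.prod IN).tangent ∞
      (fun q => (⟨((f q).1, (g q).1), ((f q).2, (g q).2)⟩ : TangentBundle (IM.prod IN) (M × N))) := by
  have := contMDiff_equivTangentBundleProd_symm (I := IM) (M := M) (I' := IN) (M' := N) (n := ∞)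
  exact this.comp (hf.prodMk hg)

/-- The partial differential at a fixed point is smooth in the parameter and the vector. -/
theorem contMDiff_partial_tangentMap [IsManifold IM ∞ M] [IsManifold IN ∞ N] [IsManifold IK ∞ K]
    {F : M × N → K} (hF : ContMDiff (IM.prod IN) IK ∞ F) (n : N) :
    ContMDiff (IM.prod 𝓘(ℝ, EN)) IK.tangent ∞
      (fun x : M × EN => tangentMap IN IK (fun y => F (x.1, y)) (⟨n, x.2⟩ : TangentBundle IN N)) := by
  -- The partial differential is the total differential on the vector `(0, v)` at `(x, n)`, which
  -- depends smoothly on `(x, v)`.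
  have h := (contMDiff_tangentMap_infty hF).comp (contMDiff_tangent_prodMk
    (contMDiff_tangent_zero.comp (contMDiff_fst (I := IM) (J := 𝓘(ℝ, EN)) (M := M) (N := EN)))
    ((contMDiff_tangent_fiber (IM := IN) n).comp
      (contMDiff_snd (I := IM) (J := 𝓘(ℝ, EN)) (M := M) (N := EN))))
  have e : ∀ x : M × EN,
      tangentMap IN IK (fun y => F (x.1, y)) (⟨n, x.2⟩ : TangentBundle IN N) =
      tangentMap (IM.prod IN) IK F
        (⟨(x.1, n), (0, x.2)⟩ : TangentBundle (IM.prod IN) (M × N)) := by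
    intro x
    rw [tangentMap_comp_apply (f := fun y => (x.1, y)) (hF.mdifferentiableAt (by simp))
      (mdifferentiableAt_const.prodMk mdifferentiableAt_id), tangentMap_prod_right]
  exact (funext e) ▸ h

end TangentMaps

set_option linter.unusedSectionVars false

/-! ### The right Maurer–Cartan form, differentials of homomorphisms, and the adjoint action -/

section MaurerCartan

variable {EG MG EK MK EQ MQ : Type*}
  [NormedAddCommGroup EG] [NormedSpace ℝ EG] [TopologicalSpace MG]
  [NormedAddCommGroup EK] [NormedSpace ℝ EK] [TopologicalSpace MK]
  [NormedAddCommGroup EQ] [NormedSpace ℝ EQ] [TopologicalSpace MQ]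
  {IG : ModelWithCorners ℝ EG MG} {IK : ModelWithCorners ℝ EK MK}
  {IQ : ModelWithCorners ℝ EQ MQ} {G K Q : Type*}
  [TopologicalSpace G] [ChartedSpace MG G] [Group G]
  [TopologicalSpace K] [ChartedSpace MK K] [Group K]
  [TopologicalSpace Q] [ChartedSpace MQ Q]

/-- The right Maurer–Cartan form `V ↦ V · g⁻¹`, on bundled tangent vectors. -/
def maurerCartan (V : TangentBundle IG G) : GroupLieAlgebra IG G :=
  rightTranslateToOne IG V.1 V.2

/-- The differential at the identity of a group homomorphism. -/
def lieMap (IG : ModelWithCorners ℝ EG MG) (IK : ModelWithCorners ℝ EK MK) (φ : G →* K) :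
    GroupLieAlgebra IG G →L[ℝ] GroupLieAlgebra IK K :=
  (mfderiv IG IK φ 1 : EG →L[ℝ] EK)

theorem maurerCartan_eq_tangentMap (V : TangentBundle IG G) :
    maurerCartan V = fiberCoord (tangentMap IG IG (fun x => x * V.1⁻¹) V) := rfl

theorem lieAd_eq_tangentMap (g : G) (A : GroupLieAlgebra IG G) :
    lieAd IG g A =
      fiberCoord (tangentMap IG IG (fun x : G => g * x * g⁻¹) (⟨1, A⟩ : TangentBundle IG G)) := rfl

theorem maurerCartan_of_fst_eq_one {V : TangentBundle IG G} (h : V.1 = 1) :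
    maurerCartan V = fiberCoord V := by
  have e : (fun x : G => x * V.1⁻¹) = id := by funext x; simp [h]
  rw [maurerCartan_eq_tangentMap, e, tangentMap_id]
  rfl

theorem maurerCartan_one (A : GroupLieAlgebra IG G) :
    maurerCartan (⟨1, A⟩ : TangentBundle IG G) = A :=
  maurerCartan_of_fst_eq_one rfl

/-- Base points such as `g * g⁻¹` equal `1` only propositionally. Keeping the vector bundled, with a
proof about its base point, avoids transport between tangent spaces that all share one model space.
-/
theorem lieMap_tangent {φ : G →* K} {V : TangentBundle IG G} (h : V.1 = 1) :
    lieMap IG IK φ (fiberCoord V : EG) = fiberCoord (tangentMap IG IK φ V) := by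
  obtain ⟨g, v⟩ := V
  obtain rfl : g = 1 := h
  rfl

theorem lieAd_tangent {g : G} {V : TangentBundle IG G} (h : V.1 = 1) :
    lieAd IG g (fiberCoord V : EG) = fiberCoord (tangentMap IG IG (fun x : G => g * x * g⁻¹) V) := by
  obtain ⟨g, v⟩ := V
  obtain rfl : g = 1 := h
  rfl

theorem lieMap_eq_zero {φ : G →* K} (h : ∀ g, φ g = 1) (A : GroupLieAlgebra IG G) :
    lieMap IG IK φ A = 0 := by
  obtain rfl : φ = 1 := MonoidHom.ext h
  exact congrArg (fun T : EG →L[ℝ] EK => T A) (mfderiv_const (I := IG) (I' := IK) (c := (1 : K)))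

theorem lieMap_id (A : GroupLieAlgebra IG G) : lieMap IG IG (MonoidHom.id G) A = A :=
  congrArg (fun T : EG →L[ℝ] EG => T A) (mfderiv_id (I := IG) (x := (1 : G)))

theorem lieAd_eq_lieMap (g : G) (A : GroupLieAlgebra IG G) :
    lieAd IG g A = lieMap IG IG (MulAut.conj g).toMonoidHom A := rfl

theorem maurerCartan_const (c : G) (V : TangentBundle IQ Q) :
    maurerCartan (tangentMap IQ IG (fun _ => c) V) = 0 := by
  rw [tangentMap_const_snd]
  exact map_zero (rightTranslateToOne IG c)

theorem lieAd_one (A : GroupLieAlgebra IG G) : lieAd IG (1 : G) A = A := by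
  refine (lieAd_eq_tangentMap (IG := IG) 1 A).trans ?_
  have e : (fun x : G => 1 * x * 1⁻¹) = id := by funext x; simp
  rw [e, tangentMap_id]
  rfl

theorem lieMap_comp {φ : G →* K} (hφ : ContMDiff IG IK ∞ φ)
    {EL ML L : Type*} [NormedAddCommGroup EL] [NormedSpace ℝ EL] [TopologicalSpace ML]
    {IL : ModelWithCorners ℝ EL ML} [TopologicalSpace L] [ChartedSpace ML L] [Group L]
    {ψ : K →* L} (hψ : ContMDiff IK IL ∞ ψ) (A : GroupLieAlgebra IG G) :
    lieMap IG IL (ψ.comp φ) A = lieMap IK IL ψ (lieMap IG IK φ A) := by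
  have h1 := lieMap_tangent (IG := IK) (IK := IL) (φ := ψ)
    (V := tangentMap IG IK φ (⟨1, A⟩ : TangentBundle IG G)) (map_one φ)
  rw [← tangentMap_comp_apply (hψ.mdifferentiableAt (by simp))
    (hφ.mdifferentiableAt (by simp))] at h1
  exact h1.symm

variable [LieGroup IG ∞ G] [LieGroup IK ∞ K]

theorem mdifferentiable_mul_right' (g : G) : MDifferentiable IG IG (fun x : G => x * g) :=
  (contMDiff_mul_right (I := IG) (n := ∞)).mdifferentiable (by simp)

theorem mdifferentiable_conj (g : G) : MDifferentiable IG IG (fun x : G => g * x * g⁻¹) :=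
  (((contMDiff_mul_left (I := IG) (n := ∞) (a := g))).mul contMDiff_const).mdifferentiable (by simp)

/-- Both partial differentials of multiplication at `(1, 1)` are the identity. -/
theorem tangentMap_mul_snd {f g : Q → G} {V : TangentBundle IQ Q}
    (hf : MDifferentiableAt IQ IG f V.1) (hg : MDifferentiableAt IQ IG g V.1)
    (hf1 : f V.1 = 1) (hg1 : g V.1 = 1) :
    fiberCoord (tangentMap IQ IG (fun q => f q * g q) V) =
      fiberCoord (tangentMap IQ IG f V) + fiberCoord (tangentMap IQ IG g V) := by
  have hm : MDifferentiableAt (IG.prod IG) IG (fun p : G × G => p.1 * p.2) (f V.1, g V.1) :=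
    (contMDiff_mul IG ∞).mdifferentiableAt (by simp)
  have h := mfderiv_comp_prod_apply hm hf hg V.2
  have e1 : (fun x : G => x * g V.1) = id := by funext x; simp [hg1]
  have e2 : (fun x : G => f V.1 * x) = id := by funext x; simp [hf1]
  have h1 : (mfderiv IG IG (fun x : G => x * g V.1) (f V.1) : EG →L[ℝ] EG) =
      ContinuousLinearMap.id ℝ EG := by rw [e1]; exact mfderiv_id
  have h2 : (mfderiv IG IG (fun x : G => f V.1 * x) (g V.1) : EG →L[ℝ] EG) =
      ContinuousLinearMap.id ℝ EG := by rw [e2]; exact mfderiv_id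
  refine Eq.trans h ?_
  exact congrArg₂ (fun a b : EG => a + b)
    (congrArg (fun T : EG →L[ℝ] EG => T (mfderiv IQ IG f V.1 V.2)) h1)
    (congrArg (fun T : EG →L[ℝ] EG => T (mfderiv IQ IG g V.1 V.2)) h2)

/-- Translating before differentiating makes the map pass through `1`, where products differentiate
additively and homomorphisms through `lieMap`. -/
theorem maurerCartan_tangentMap {f : Q → G} {V : TangentBundle IQ Q}
    (hf : MDifferentiableAt IQ IG f V.1) :
    maurerCartan (tangentMap IQ IG f V) =
      fiberCoord (tangentMap IQ IG (fun q => f q * (f V.1)⁻¹) V) := by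
  rw [maurerCartan_eq_tangentMap,
    tangentMap_comp_apply (g := fun x => x * (f V.1)⁻¹) (mdifferentiable_mul_right' _ _) hf]
  rfl

/-- With `f₀`, `g₀` the values at the base point, `f g (f₀ g₀)⁻¹` is the product of `f f₀⁻¹` and the
conjugate by `f₀` of `g g₀⁻¹`. Both factors pass through `1`, so their derivatives add. -/
theorem maurerCartan_mul {f g : Q → G} {V : TangentBundle IQ Q}
    (hf : MDifferentiableAt IQ IG f V.1) (hg : MDifferentiableAt IQ IG g V.1) :
    maurerCartan (tangentMap IQ IG (fun q => f q * g q) V) =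
      maurerCartan (tangentMap IQ IG f V) +
        lieAd IG (f V.1) (maurerCartan (tangentMap IQ IG g V)) := by
  have hfg : MDifferentiableAt IQ IG (fun q => f q * g q) V.1 :=
    MDifferentiableAt.comp (g := fun p : G × G => p.1 * p.2) V.1
      ((contMDiff_mul IG ∞).mdifferentiableAt (by simp)) (hf.prodMk hg)
  have hf' : MDifferentiableAt IQ IG (fun q => f q * (f V.1)⁻¹) V.1 :=
    (mdifferentiable_mul_right' (f V.1)⁻¹ _).comp V.1 hf
  have hg' : MDifferentiableAt IQ IG (fun q => g q * (g V.1)⁻¹) V.1 :=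
    (mdifferentiable_mul_right' (g V.1)⁻¹ _).comp V.1 hg
  have hc := (mdifferentiable_conj (IG := IG) (f V.1)) (g V.1 * (g V.1)⁻¹)
  have e : (fun q => f q * g q * (f V.1 * g V.1)⁻¹) =
      fun q => (f q * (f V.1)⁻¹) * (f V.1 * (g q * (g V.1)⁻¹) * (f V.1)⁻¹) := by
    funext q; group
  have h := tangentMap_mul_snd hf' (MDifferentiableAt.comp V.1 hc hg') (by simp) (by simp)
  refine (maurerCartan_tangentMap hfg).trans ?_
  rw [e]
  refine h.trans ?_
  refine congrArg₂ (fun a b : EG => a + b) (maurerCartan_tangentMap hf).symm ?_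
  have h3 := maurerCartan_tangentMap hg
  have h4 := lieAd_tangent (IG := IG) (g := f V.1)
    (V := tangentMap IQ IG (fun q => g q * (g V.1)⁻¹) V) (mul_inv_cancel (g V.1))
  rw [← tangentMap_comp_apply (g := fun x => f V.1 * x * (f V.1)⁻¹) hc hg'] at h4
  exact h4.symm.trans (congrArg (fun a : EG => (lieAd IG (f V.1) a : EG)) h3.symm)

theorem maurerCartan_hom {φ : G →* K} (hφ : ContMDiff IG IK ∞ φ) {f : Q → G}
    {V : TangentBundle IQ Q} (hf : MDifferentiableAt IQ IG f V.1) :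
    maurerCartan (tangentMap IQ IK (fun q => φ (f q)) V) =
      lieMap IG IK φ (maurerCartan (tangentMap IQ IG f V)) := by
  have hφ' : ∀ x, MDifferentiableAt IG IK φ x := fun x => hφ.mdifferentiableAt (by simp)
  have hf' : MDifferentiableAt IQ IG (fun q => f q * (f V.1)⁻¹) V.1 :=
    (mdifferentiable_mul_right' (f V.1)⁻¹ _).comp V.1 hf
  have e : (fun q => φ (f q) * (φ (f V.1))⁻¹) = fun q => φ (f q * (f V.1)⁻¹) := by
    funext q; simp
  refine (maurerCartan_tangentMap (MDifferentiableAt.comp V.1 (g := φ) (hφ' _) hf)).trans ?_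
  have h4 := lieMap_tangent (IG := IG) (IK := IK) (φ := φ)
    (V := tangentMap IQ IG (fun q => f q * (f V.1)⁻¹) V) (mul_inv_cancel (f V.1))
  rw [← tangentMap_comp_apply (hφ' _) hf'] at h4
  show (fiberCoord (tangentMap IQ IK (fun q => φ (f q) * (φ (f V.1))⁻¹) V) : EK) = _
  rw [e]
  exact h4.symm.trans
    (congrArg (fun a : EG => (lieMap IG IK φ a : EK)) (maurerCartan_tangentMap hf).symm)

/-- Apply the product rule to the constant function `f⁻¹ f = 1`. -/
theorem maurerCartan_inv {f : Q → G} {V : TangentBundle IQ Q}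
    (hf : MDifferentiableAt IQ IG f V.1) :
    maurerCartan (tangentMap IQ IG (fun q => (f q)⁻¹) V) =
      -lieAd IG (f V.1)⁻¹ (maurerCartan (tangentMap IQ IG f V)) := by
  have hi : MDifferentiableAt IQ IG (fun q => (f q)⁻¹) V.1 :=
    MDifferentiableAt.comp V.1 (g := fun x : G => x⁻¹)
      ((contMDiff_inv IG ∞).mdifferentiableAt (by simp)) hf
  have h := maurerCartan_mul hi hf
  simp only [inv_mul_cancel] at h
  rw [maurerCartan_const] at h
  exact eq_neg_of_add_eq_zero_left h.symm

theorem lieAd_mul (g h : G) (A : GroupLieAlgebra IG G) :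
    lieAd IG (g * h) A = lieAd IG g (lieAd IG h A) := by
  have h4 := lieAd_tangent (IG := IG) (g := g)
    (V := tangentMap IG IG (fun x : G => h * x * h⁻¹) (⟨1, A⟩ : TangentBundle IG G)) (by
      show h * 1 * h⁻¹ = 1
      group)
  rw [← tangentMap_comp_apply (mdifferentiable_conj (IG := IG) g _)
    (mdifferentiable_conj (IG := IG) h _)] at h4
  have e : (fun x : G => g * h * x * (g * h)⁻¹) = fun x => g * (h * x * h⁻¹) * g⁻¹ := by
    funext x; group
  refine (lieAd_eq_tangentMap (IG := IG) (g * h) A).trans ?_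
  rw [e]
  exact h4.symm

/-- The differential of a homomorphism intertwines the adjoint actions. -/
theorem lieMap_lieAd {φ : G →* K} (hφ : ContMDiff IG IK ∞ φ) (g : G) (A : GroupLieAlgebra IG G) :
    lieMap IG IK φ (lieAd IG g A) = lieAd IK (φ g) (lieMap IG IK φ A) := by
  have hφ' : ∀ x, MDifferentiableAt IG IK φ x := fun x => hφ.mdifferentiableAt (by simp)
  have h1 := lieMap_tangent (IG := IG) (IK := IK) (φ := φ)
    (V := tangentMap IG IG (fun x : G => g * x * g⁻¹) (⟨1, A⟩ : TangentBundle IG G)) (by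
      show g * 1 * g⁻¹ = 1
      group)
  have h2 := lieAd_tangent (IG := IK) (g := φ g)
    (V := tangentMap IG IK φ (⟨1, A⟩ : TangentBundle IG G)) (map_one φ)
  rw [← tangentMap_comp_apply (hφ' _) (mdifferentiable_conj (IG := IG) g _)] at h1
  rw [← tangentMap_comp_apply (mdifferentiable_conj (IG := IK) (φ g) _) (hφ' _)] at h2
  have e : (fun x : G => φ (g * x * g⁻¹)) = fun x => φ g * φ x * (φ g)⁻¹ := by funext x; simp
  rw [e] at h1
  exact h1.trans h2.symm

/-- Lets the product rule compute the differential of a homomorphism that is written as a product of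
maps. -/
theorem lieMap_eq_maurerCartan {φ : G →* K} (hφ : ContMDiff IG IK ∞ φ) (A : GroupLieAlgebra IG G) :
    lieMap IG IK φ A = maurerCartan (tangentMap IG IK φ (⟨1, A⟩ : TangentBundle IG G)) := by
  have h := maurerCartan_hom hφ (V := (⟨1, A⟩ : TangentBundle IG G)) (f := id) mdifferentiableAt_id
  rw [tangentMap_id] at h
  exact (h.trans (congrArg (lieMap IG IK φ) (maurerCartan_one A))).symm

/-- Conjugating a homomorphism acts on its differential by the adjoint action. -/
theorem lieAd_lieMap_of_conj {φ ψ : G →* K} (hφ : ContMDiff IG IK ∞ φ) (k : K)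
    (h : ∀ x, k * φ x * k⁻¹ = ψ x) (A : GroupLieAlgebra IG G) :
    lieAd IK k (lieMap IG IK φ A) = lieMap IG IK ψ A := by
  have hk : ContMDiff IK IK ∞ (MulAut.conj k).toMonoidHom :=
    (contMDiff_mul_left (I := IK) (n := ∞) (a := k)).mul contMDiff_const
  rw [lieAd_eq_lieMap, ← lieMap_comp hφ hk]
  congr 1
  exact congrArg (lieMap IG IK) (MonoidHom.ext h)

/-- The value at `V` over `g` is the differential of multiplication on the pair `(V, 0)` at `(g,
g⁻¹)`, a pair depending smoothly on `V`. -/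
theorem contMDiff_maurerCartan :
    ContMDiff (M' := EG) IG.tangent 𝓘(ℝ, EG) ∞
      (fun V : TangentBundle IG G => (maurerCartan V : EG)) := by
  have hp : ContMDiff IG.tangent IG ∞ (fun V : TangentBundle IG G => V.1) :=
    Bundle.contMDiff_proj (TangentSpace IG : G → Type _)
  have h := (contMDiff_tangentMap_infty (contMDiff_mul IG ∞ (G := G))).comp
    (contMDiff_tangent_prodMk (contMDiff_id (M := TangentBundle IG G) (I := IG.tangent))
      (contMDiff_tangent_zero.comp hp.inv))
  refine (contMDiff_snd_of_tangent 1 h fun V => mul_inv_cancel V.1).congr fun V => ?_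
  rw [maurerCartan_eq_tangentMap, tangentMap_comp_apply (g := fun p : G × G => p.1 * p.2)
    (f := fun x => (x, V.1⁻¹)) ((contMDiff_mul IG ∞).mdifferentiableAt (by simp))
    (mdifferentiableAt_id.prodMk mdifferentiableAt_const), tangentMap_prod_left]
  rfl

/-- The adjoint action is the partial differential at `x = 1` of the smooth map `(g, x) ↦ g x g⁻¹`.
-/
theorem contMDiff_lieAd :
    ContMDiff (M' := EG) (IG.prod 𝓘(ℝ, EG)) 𝓘(ℝ, EG) ∞
      (fun x : G × EG => (lieAd IG x.1 (x.2 : GroupLieAlgebra IG G) : EG)) := by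
  have hF : ContMDiff (IG.prod IG) IG ∞ (fun p : G × G => p.1 * p.2 * p.1⁻¹) :=
    (contMDiff_fst.mul contMDiff_snd).mul contMDiff_fst.inv
  exact contMDiff_snd_of_tangent 1 (contMDiff_partial_tangentMap hF 1)
    fun x => by show x.1 * 1 * x.1⁻¹ = 1; group

end MaurerCartan

/-! ### Source and target kernels in `H ⋊ G` and the resulting linear algebra of `L(H) ⊕ L(G)` -/

section CrossedModules

variable {EG MG EH MH EM MM : Type*}
  [NormedAddCommGroup EG] [NormedSpace ℝ EG] [TopologicalSpace MG]
  [NormedAddCommGroup EH] [NormedSpace ℝ EH] [TopologicalSpace MH]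
  [NormedAddCommGroup EM] [NormedSpace ℝ EM] [TopologicalSpace MM]
  {IG : ModelWithCorners ℝ EG MG} {IH : ModelWithCorners ℝ EH MH}
  {IM : ModelWithCorners ℝ EM MM} {G H M : Type*}
  [TopologicalSpace G] [ChartedSpace MG G] [Group G]
  [TopologicalSpace H] [ChartedSpace MH H] [Group H]
  [TopologicalSpace M] [ChartedSpace MM M]

/-- The value of a Lie algebra valued form on a bundled tangent vector. -/
def LieForm.eval (θ : LieForm IM M IG G) (V : TangentBundle IM M) : GroupLieAlgebra IG G :=
  θ V.1 V.2

namespace LieCrossedModule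

variable (C : LieCrossedModule IG IH G H)

/-- The inclusion `h ↦ (h, 1)` of `H` into `H ⋊ G`. -/
def inH : H →* C.Mor where
  toFun h := C.mor h 1
  map_one' := rfl
  map_mul' a b := Prod.ext (by show a * b = a * C.α 1 b; simp) (mul_one 1).symm

/-- The inclusion `g ↦ (1, g)` of `G` into `H ⋊ G`. -/
def inG : G →* C.Mor where
  toFun g := C.mor 1 g
  map_one' := rfl
  map_mul' a b := Prod.ext (by show (1 : H) = 1 * C.α a 1; simp) rfl

/-- The source homomorphism `H ⋊ G → G`. -/
def srcHom : C.Mor →* G where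
  toFun k := k.src
  map_one' := rfl
  map_mul' _ _ := rfl

/-- The target homomorphism `H ⋊ G → G`. -/
def tgtHom : C.Mor →* G where
  toFun k := k.tgt
  map_one' := by show C.τ 1 * 1 = 1; simp
  map_mul' a b := by
    show C.τ (a.1 * C.α a.2 b.1) * (a.2 * b.2) = (C.τ a.1 * a.2) * (C.τ b.1 * b.2)
    rw [map_mul, C.τ_α]
    group

/-- The homomorphism `h ↦ (h⁻¹, τ h)` of `H` onto the kernel of the target homomorphism. -/
def tgtKer : H →* C.Mor where
  toFun h := C.mor h⁻¹ (C.τ h)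
  map_one' := Prod.ext inv_one (map_one C.τ)
  map_mul' a b := Prod.ext (by
    show (a * b)⁻¹ = a⁻¹ * C.α (C.τ a) b⁻¹
    rw [C.α_τ]
    group) (map_mul C.τ a b)

variable {C} in
theorem Mor.eq_inH_mul_inG (k : C.Mor) : k = C.inH k.hPart * C.inG k.src :=
  Prod.ext (by show k.1 = k.1 * C.α 1 1; simp) (one_mul k.2).symm

theorem tgtKer_apply (h : H) : C.tgtKer h = C.inH h⁻¹ * C.inG (C.τ h) :=
  (C.tgtKer h).eq_inH_mul_inG

/-- By the Peiffer identity, conjugation by the `H`-part of `k` is `α` at its image under `τ`;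
together with `α` at the `G`-part this is `α` at the target. -/
theorem conj_inH (k : C.Mor) (h : H) :
    k * C.inH h * k⁻¹ = C.inH (C.α k.tgt h) := by
  rw [mul_inv_eq_iff_eq_mul]
  refine Prod.ext ?_ ?_
  · show k.1 * C.α k.2 h = C.α (C.τ k.1 * k.2) h * C.α 1 k.1
    rw [map_mul, MulAut.mul_apply, C.α_τ]
    simp
  · show k.2 * 1 = 1 * k.2
    simp

/-- By the Peiffer identity the kernels of source and target centralise each other, so the `H`-part
of `k` has no effect and only `α` at the source survives. -/
theorem conj_tgtKer (k : C.Mor) (h : H) :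
    k * C.tgtKer h * k⁻¹ = C.tgtKer (C.α k.src h) := by
  rw [mul_inv_eq_iff_eq_mul]
  refine Prod.ext ?_ ?_
  · show k.1 * C.α k.2 h⁻¹ = (C.α k.2 h)⁻¹ * C.α (C.τ (C.α k.2 h)) k.1
    rw [C.α_τ, map_inv]
    group
  · show k.2 * C.τ h = C.τ (C.α k.2 h) * k.2
    rw [C.τ_α]
    group

theorem contMDiff_inH : ContMDiff IH (IH.prod IG) ∞ C.inH :=
  contMDiff_id.prodMk contMDiff_const

theorem contMDiff_inG : ContMDiff IG (IH.prod IG) ∞ C.inG :=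
  contMDiff_const.prodMk contMDiff_id

theorem contMDiff_srcHom : ContMDiff (IH.prod IG) IG ∞ C.srcHom :=
  contMDiff_snd (I := IH) (J := IG) (M := H) (N := G)

theorem contMDiff_α_apply (g : G) : ContMDiff IH IH ∞ (C.α g) :=
  C.contMDiff_α.comp (contMDiff_const.prodMk contMDiff_id)

theorem lieMap_inH (A : GroupLieAlgebra IH H) :
    lieMap IH (IH.prod IG) C.inH A = C.lieSplit.symm (A, 0) :=
  congrArg (fun T : EH →L[ℝ] EH × EG => T A)
    (mfderiv_prod_left (I := IH) (I' := IG) (x₀ := (1 : H)) (y₀ := (1 : G)))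

theorem lieMap_inG (B : GroupLieAlgebra IG G) :
    lieMap IG (IH.prod IG) C.inG B = C.lieSplit.symm (0, B) :=
  congrArg (fun T : EG →L[ℝ] EH × EG => T B)
    (mfderiv_prod_right (I := IH) (I' := IG) (x₀ := (1 : H)) (y₀ := (1 : G)))

theorem lieα_eq_lieMap (g : G) (A : GroupLieAlgebra IH H) :
    C.lieα g A = lieMap IH IH (C.α g).toMonoidHom A := rfl

variable {C} in
-- Reduces identities of linear maps on `L(H ⋊ G)` to the images of `inH` and `inG`, where they come
-- from identities of homomorphisms.
theorem lieSplit_decomposition (K : GroupLieAlgebra (IH.prod IG) C.Mor) :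
    K = lieMap IH (IH.prod IG) C.inH (C.lieSplit K).1 + lieMap IG (IH.prod IG) C.inG (lieSrc K) := by
  rw [lieMap_inH, lieMap_inG, ← map_add]
  refine C.lieSplit.injective ?_
  rw [C.lieSplit.apply_symm_apply, Prod.mk_add_mk, add_zero, zero_add]
  rfl

theorem lieUnit_eq_lieMap (B : GroupLieAlgebra IG G) :
    C.lieUnit B = lieMap IG (IH.prod IG) C.inG B := (C.lieMap_inG B).symm

variable {C} in
-- Composition in a linear groupoid is the sum minus the unit at the middle object. Written this way
-- it is linear and commutes visibly with linear maps; composability is not needed for the formula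
-- itself.
theorem lieComp_eq (K₂ K₁ : GroupLieAlgebra (IH.prod IG) C.Mor) :
    lieComp K₂ K₁ = K₂ + K₁ - lieMap IG (IH.prod IG) C.inG (lieSrc K₂) := by
  refine C.lieSplit.injective ?_
  rw [map_sub, map_add, lieMap_inG, lieComp, C.lieSplit.apply_symm_apply,
    C.lieSplit.apply_symm_apply]
  exact Prod.ext (sub_zero _).symm (add_sub_cancel_left _ _).symm

variable [LieGroup IG ∞ G] [LieGroup IH ∞ H]

theorem contMDiff_tgtHom : ContMDiff (IH.prod IG) IG ∞ C.tgtHom :=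
  (C.contMDiff_τ.comp (contMDiff_fst (I := IH) (J := IG) (M := H) (N := G))).mul
    (contMDiff_snd (I := IH) (J := IG) (M := H) (N := G))

theorem contMDiff_tgtKer : ContMDiff IH (IH.prod IG) ∞ C.tgtKer :=
  ContMDiff.prodMk (contMDiff_inv IH ∞) C.contMDiff_τ

variable {C} in
-- The source kills `inH` and splits `inG`. As the differential of a homomorphism it is linear and
-- intertwines the adjoint actions.
theorem lieSrc_eq_lieMap (K : GroupLieAlgebra (IH.prod IG) C.Mor) :
    lieSrc K = lieMap (IH.prod IG) IG C.srcHom K := by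
  conv_rhs => rw [lieSplit_decomposition K]
  rw [map_add, ← lieMap_comp C.contMDiff_inH C.contMDiff_srcHom,
    ← lieMap_comp C.contMDiff_inG C.contMDiff_srcHom, lieMap_eq_zero (fun _ => rfl), zero_add]
  exact (lieMap_id _).symm

variable {C} in
theorem lieTgt_eq_lieMap (K : GroupLieAlgebra (IH.prod IG) C.Mor) :
    lieTgt K = lieMap (IH.prod IG) IG C.tgtHom K := by
  conv_rhs => rw [lieSplit_decomposition K]
  rw [map_add, ← lieMap_comp C.contMDiff_inH C.contMDiff_tgtHom,
    ← lieMap_comp C.contMDiff_inG C.contMDiff_tgtHom]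
  have h1 : C.tgtHom.comp C.inH = C.τ := MonoidHom.ext fun h => mul_one _
  have h2 : C.tgtHom.comp C.inG = MonoidHom.id G := MonoidHom.ext fun g => by
    show C.τ 1 * g = g
    simp
  rw [h1, h2, lieMap_id]
  rfl

/-- Product rule for `tgtKer h = inH h⁻¹ * inG (τ h)` at `h = 1`, where both adjoint factors are
trivial. In coordinates the value is `(-A, τ A)`. -/
theorem lieMap_tgtKer (A : GroupLieAlgebra IH H) :
    lieMap IH (IH.prod IG) C.tgtKer A =
      lieMap IG (IH.prod IG) C.inG (C.lieτ A) - lieMap IH (IH.prod IG) C.inH A := by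
  have hH := (contMDiff_inv IH ∞ (G := H)).mdifferentiableAt (x := 1) (by simp)
  have e : (C.tgtKer : H → C.Mor) = fun h => C.inH h⁻¹ * C.inG (C.τ h) :=
    funext C.tgtKer_apply
  rw [lieMap_eq_maurerCartan C.contMDiff_tgtKer, e, maurerCartan_mul
    (f := fun h => C.inH h⁻¹) (g := fun h => C.inG (C.τ h))
    (((C.contMDiff_inH).comp (contMDiff_inv IH ∞)).mdifferentiableAt (by simp))
    (((C.contMDiff_inG).comp C.contMDiff_τ).mdifferentiableAt (by simp)),
    maurerCartan_hom C.contMDiff_inH hH,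
    maurerCartan_hom C.contMDiff_inG (C.contMDiff_τ.mdifferentiableAt (by simp)),
    ← lieMap_eq_maurerCartan C.contMDiff_τ]
  have h1 := maurerCartan_inv (IG := IH) (f := fun x : H => x)
    (V := (⟨1, A⟩ : TangentBundle IH H)) mdifferentiableAt_id
  have h2 : tangentMap IH IH (fun x : H => x) (⟨1, A⟩ : TangentBundle IH H) = ⟨1, A⟩ :=
    congrFun tangentMap_id _
  rw [h2, maurerCartan_one] at h1
  simp only [inv_one] at h1 ⊢
  rw [lieAd_one] at h1
  rw [h1, map_neg, map_one, lieAd_one, neg_add_eq_sub]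
  rfl

/-- Infinitesimal form of `conj_inH`. With its counterpart for `tgtKer` it describes how the adjoint
action preserves the kernels of source and target. -/
theorem lieAd_lieMap_inH (k : C.Mor) (A : GroupLieAlgebra IH H) :
    lieAd (IH.prod IG) k (lieMap IH (IH.prod IG) C.inH A) =
      lieMap IH (IH.prod IG) C.inH (C.lieα k.tgt A) := by
  rw [lieα_eq_lieMap, ← lieMap_comp (C.contMDiff_α_apply _) C.contMDiff_inH]
  exact lieAd_lieMap_of_conj C.contMDiff_inH k (C.conj_inH k) A

theorem lieAd_lieMap_tgtKer (k : C.Mor) (A : GroupLieAlgebra IH H) :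
    lieAd (IH.prod IG) k (lieMap IH (IH.prod IG) C.tgtKer A) =
      lieMap IH (IH.prod IG) C.tgtKer (C.lieα k.src A) := by
  rw [lieα_eq_lieMap, ← lieMap_comp (C.contMDiff_α_apply _) C.contMDiff_tgtKer]
  exact lieAd_lieMap_of_conj C.contMDiff_tgtKer k (C.conj_tgtKer k) A

theorem lieAd_inG (g : G) (B : GroupLieAlgebra IG G) :
    lieAd (IH.prod IG) (C.inG g) (lieMap IG (IH.prod IG) C.inG B) =
      lieMap IG (IH.prod IG) C.inG (lieAd IG g B) :=
  (lieMap_lieAd C.contMDiff_inG g B).symm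

theorem lieα_one (A : GroupLieAlgebra IH H) : C.lieα 1 A = A := by
  have h : (C.α 1).toMonoidHom = MonoidHom.id H := MonoidHom.ext fun x => by
    show C.α 1 x = x
    simp
  rw [lieα_eq_lieMap, h, lieMap_id]

variable {C} in
theorem lieTgt_lieAd (k : C.Mor) (K : GroupLieAlgebra (IH.prod IG) C.Mor) :
    lieTgt (lieAd (IH.prod IG) k K) = lieAd IG k.tgt (lieTgt K) := by
  rw [lieTgt_eq_lieMap, lieTgt_eq_lieMap, lieMap_lieAd C.contMDiff_tgtHom]
  rfl

theorem lieSrc_inH (A : GroupLieAlgebra IH H) :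
    lieSrc (lieMap IH (IH.prod IG) C.inH A) = 0 := by
  rw [lieMap_inH]; rfl

theorem lieSrc_inG (B : GroupLieAlgebra IG G) :
    lieSrc (lieMap IG (IH.prod IG) C.inG B) = B := by
  rw [lieMap_inG]; rfl

theorem lieTgt_inH (A : GroupLieAlgebra IH H) :
    lieTgt (lieMap IH (IH.prod IG) C.inH A) = C.lieτ A := by
  rw [lieMap_inH, lieTgt, C.lieSplit.apply_symm_apply, add_zero]

theorem lieTgt_inG (B : GroupLieAlgebra IG G) :
    lieTgt (lieMap IG (IH.prod IG) C.inG B) = B := by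
  rw [lieMap_inG, lieTgt, C.lieSplit.apply_symm_apply, map_zero, zero_add]

variable {C} in
theorem lieSrc_add (K L : GroupLieAlgebra (IH.prod IG) C.Mor) :
    lieSrc (K + L) = lieSrc K + lieSrc L := by
  simp only [lieSrc_eq_lieMap, map_add]

variable {C} in
theorem lieTgt_add (K L : GroupLieAlgebra (IH.prod IG) C.Mor) :
    lieTgt (K + L) = lieTgt K + lieTgt L := by
  simp only [lieTgt_eq_lieMap, map_add]

variable {C} in
theorem lieSrc_sub (K L : GroupLieAlgebra (IH.prod IG) C.Mor) :
    lieSrc (K - L) = lieSrc K - lieSrc L := by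
  simp only [lieSrc_eq_lieMap, map_sub]

variable {C} in
theorem lieTgt_sub (K L : GroupLieAlgebra (IH.prod IG) C.Mor) :
    lieTgt (K - L) = lieTgt K - lieTgt L := by
  simp only [lieTgt_eq_lieMap, map_sub]

theorem lieSrc_tgtKer (A : GroupLieAlgebra IH H) :
    lieSrc (lieMap IH (IH.prod IG) C.tgtKer A) = C.lieτ A := by
  rw [lieMap_tgtKer, lieSrc_sub, lieSrc_inG, lieSrc_inH, sub_zero]

theorem lieTgt_tgtKer (A : GroupLieAlgebra IH H) :
    lieTgt (lieMap IH (IH.prod IG) C.tgtKer A) = 0 := by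
  rw [lieMap_tgtKer, lieTgt_sub, lieTgt_inG, lieTgt_inH, sub_self]

variable {C} in
/-- Elements of `L(H)` act on an element of `L(H) ⊕ L(G)` as on the unit at its target. -/
theorem lieAd_inH_sub (h : H) (K : GroupLieAlgebra (IH.prod IG) C.Mor) :
    lieAd (IH.prod IG) (C.inH h) (K - lieMap IG (IH.prod IG) C.inG (lieTgt K)) =
      K - lieMap IG (IH.prod IG) C.inG (lieTgt K) := by
  -- Subtracting the unit at its own target moves `K` into the kernel of the target. The adjoint
  -- action there depends only on the source of the group element, which is `1` for `inH h`.
  have e : K - lieMap IG (IH.prod IG) C.inG (lieTgt K) =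
      -lieMap IH (IH.prod IG) C.tgtKer (C.lieSplit K).1 := by
    rw [lieMap_tgtKer, neg_sub]
    conv_lhs => rw [lieSplit_decomposition K]
    rw [lieTgt_add, lieTgt_inH, lieTgt_inG, map_add]
    abel
  rw [e, map_neg, lieAd_lieMap_tgtKer]
  exact congrArg (fun A => -lieMap IH (IH.prod IG) C.tgtKer A) (C.lieα_one _)

/-- Take sources in the adjoint rule for `tgtKer` at `k = inG g`: the source of `tgtKer` is `τ`. -/
theorem lieτ_lieα (g : G) (A : GroupLieAlgebra IH H) :
    C.lieτ (C.lieα g A) = lieAd IG g (C.lieτ A) := by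
  have h1 := C.lieAd_lieMap_tgtKer (C.inG g) A
  have h2 := congrArg lieSrc h1
  rw [lieSrc_tgtKer, lieSrc_eq_lieMap, lieMap_lieAd C.contMDiff_srcHom, ← lieSrc_eq_lieMap,
    lieSrc_tgtKer] at h2
  exact h2.symm

end LieCrossedModule

end CrossedModules

/-- Moves a vector to a propositionally equal base point, as in `p · 1 = p`, with the same
coordinates in the model space. -/
theorem tangentBundle_mk_congr {EM MM M : Type*} [NormedAddCommGroup EM] [NormedSpace ℝ EM]
    [TopologicalSpace MM] {IM : ModelWithCorners ℝ EM MM} [TopologicalSpace M] [ChartedSpace MM M]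
    {p q : M} (h : p = q) (v : EM) :
    (⟨p, v⟩ : TangentBundle IM M) = ⟨q, v⟩ := by
  subst h; rfl

/-! ### Smoothness of sums, differences and linear images of vector-valued maps -/

section VectorValued

variable {EM MM M E F : Type*} [NormedAddCommGroup EM] [NormedSpace ℝ EM]
  [TopologicalSpace MM] {IM : ModelWithCorners ℝ EM MM} [TopologicalSpace M] [ChartedSpace MM M]
  [NormedAddCommGroup E] [NormedSpace ℝ E] [NormedAddCommGroup F] [NormedSpace ℝ F]

theorem contMDiff_vector_add {f g : M → E} (hf : ContMDiff IM 𝓘(ℝ, E) ∞ f)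
    (hg : ContMDiff IM 𝓘(ℝ, E) ∞ g) : ContMDiff IM 𝓘(ℝ, E) ∞ (fun x => f x + g x) :=
  hf.add hg

theorem contMDiff_vector_sub {f g : M → E} (hf : ContMDiff IM 𝓘(ℝ, E) ∞ f)
    (hg : ContMDiff IM 𝓘(ℝ, E) ∞ g) : ContMDiff IM 𝓘(ℝ, E) ∞ (fun x => f x - g x) :=
  hf.sub hg

theorem contMDiff_vector_clm (T : E →L[ℝ] F) {f : M → E} (hf : ContMDiff IM 𝓘(ℝ, E) ∞ f) :
    ContMDiff IM 𝓘(ℝ, F) ∞ (fun x => T (f x)) :=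
  T.contMDiff.comp hf

end VectorValued

/-! ### Fundamental vector fields and connections on ordinary principal bundles -/

section PrincipalBundles

variable {EG MG EM MM EP MP EQ MQ : Type*}
  [NormedAddCommGroup EG] [NormedSpace ℝ EG] [TopologicalSpace MG]
  [NormedAddCommGroup EM] [NormedSpace ℝ EM] [TopologicalSpace MM]
  [NormedAddCommGroup EP] [NormedSpace ℝ EP] [TopologicalSpace MP]
  [NormedAddCommGroup EQ] [NormedSpace ℝ EQ] [TopologicalSpace MQ]
  {IG : ModelWithCorners ℝ EG MG} {IP : ModelWithCorners ℝ EP MP}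
  {IM : ModelWithCorners ℝ EM MM} {IQ : ModelWithCorners ℝ EQ MQ} {G P M Q : Type*}
  [TopologicalSpace G] [ChartedSpace MG G] [Group G]
  [TopologicalSpace P] [ChartedSpace MP P] [TopologicalSpace M] [ChartedSpace MM M]
  [TopologicalSpace Q] [ChartedSpace MQ Q]

namespace PrincipalBundle

variable (B : PrincipalBundle IG IP IM G P M)

/-- The value at `p` of the fundamental vector field of `A`, as a bundled tangent vector. -/
def fundamentalVector (p : P) (A : GroupLieAlgebra IG G) : TangentBundle IP P :=
  tangentMap IG IP (fun g => B.act p g) (⟨1, A⟩ : TangentBundle IG G)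

/-- As a tangent map, the fundamental vector is based at `p · 1`; this identifies it with the same
vector based at `p`. -/
theorem mk_fundamental (p : P) (A : GroupLieAlgebra IG G) :
    (⟨p, B.fundamental p A⟩ : TangentBundle IP P) = B.fundamentalVector p A :=
  tangentBundle_mk_congr (EM := EP) (B.act_one p).symm (B.fundamental p A)

theorem form_fundamental {EK MK K : Type*} [NormedAddCommGroup EK] [NormedSpace ℝ EK]
    [TopologicalSpace MK] {IK : ModelWithCorners ℝ EK MK} [TopologicalSpace K] [ChartedSpace MK K]
    [Group K] (θ : LieForm IP P IK K) (p : P) (A : GroupLieAlgebra IG G) :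
    θ p (B.fundamental p A) = θ.eval (B.fundamentalVector p A) := by
  rw [← mk_fundamental]
  rfl

theorem contMDiff_act_left (g : G) : ContMDiff IP IP ∞ (fun p => B.act p g) :=
  B.contMDiff_act.comp (contMDiff_id.prodMk contMDiff_const)

theorem contMDiff_act_right (p : P) : ContMDiff IG IP ∞ (fun g => B.act p g) :=
  B.contMDiff_act.comp (contMDiff_const.prodMk contMDiff_id)

theorem contMDiff_fundamentalVector [IsManifold IP ∞ P] [LieGroup IG ∞ G] :
    ContMDiff (IP.prod 𝓘(ℝ, EG)) IP.tangent ∞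
      (fun x : P × EG => B.fundamentalVector x.1 x.2) :=
  contMDiff_partial_tangentMap B.contMDiff_act 1

/-- Differentiate `(p x) g = (p g)(g⁻¹ x g)` in `x` at `1`. -/
theorem tangentMap_act_fundamentalVector [LieGroup IG ∞ G] (p : P) (g : G)
    (A : GroupLieAlgebra IG G) :
    tangentMap IP IP (fun q => B.act q g) (B.fundamentalVector p A) =
      B.fundamentalVector (B.act p g) (lieAd IG g⁻¹ A) := by
  have e1 : (tangentMap IG IG (fun x : G => g⁻¹ * x * g⁻¹⁻¹) (⟨1, A⟩ : TangentBundle IG G)) =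
      ⟨1, lieAd IG g⁻¹ A⟩ :=
    tangentBundle_mk_congr (EM := EG) (by group) (lieAd IG g⁻¹ A)
  rw [fundamentalVector, fundamentalVector, ← e1,
    ← tangentMap_comp_apply ((B.contMDiff_act_left g).mdifferentiableAt (by simp))
      ((B.contMDiff_act_right p).mdifferentiableAt (by simp)),
    ← tangentMap_comp_apply ((B.contMDiff_act_right _).mdifferentiableAt (by simp))
      (mdifferentiable_conj _ _)]
  have e2 : (fun x => B.act (B.act p x) g) =
      fun x => B.act (B.act p g) (g⁻¹ * x * g⁻¹⁻¹) := by
    funext x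
    rw [← B.act_mul, ← B.act_mul]
    congr 1
    group
  rw [e2]

variable {B}

/-- A connection form evaluated on the derivative of `q ↦ m(q) g(q)`. -/
theorem IsConnection.eval_act [IsManifold IP ∞ P] [LieGroup IG ∞ G] {θ : LieForm IP P IG G}
    (hθ : B.IsConnection θ) {m : Q → P} {g : Q → G} {V : TangentBundle IQ Q}
    (hm : MDifferentiableAt IQ IP m V.1) (hg : MDifferentiableAt IQ IG g V.1) :
    θ.eval (tangentMap IQ IP (fun q => B.act (m q) (g q)) V) =
      lieAd IG (g V.1)⁻¹
        (θ.eval (tangentMap IQ IP m V) + maurerCartan (tangentMap IQ IG g V)) := by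
  have hF := B.contMDiff_act.mdifferentiableAt (x := (m V.1, g V.1)) (by simp)
  have h1 := mfderiv_comp_prod_apply hF hm hg V.2
  -- Leibniz rule: one term moves `m` with the group element frozen, the other moves the group
  -- element with `m` frozen.
  have h2 : θ.eval (tangentMap IQ IP (fun q => B.act (m q) (g q)) V) =
      θ.eval (tangentMap IP IP (fun p => B.act p (g V.1)) (tangentMap IQ IP m V)) +
      θ.eval (tangentMap IG IP (fun x => B.act (m V.1) x) (tangentMap IQ IG g V)) :=
    (congrArg (θ (B.act (m V.1) (g V.1))) h1).trans (map_add (θ _) _ _)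
  -- Since `m x = (m (x g⁻¹)) g`, the second term is the right translate by `g` of a fundamental
  -- vector, so equivariance and verticality evaluate it.
  have h3 : tangentMap IG IP (fun x => B.act (m V.1) x) (tangentMap IQ IG g V) =
      tangentMap IP IP (fun p => B.act p (g V.1))
        (B.fundamentalVector (m V.1) (maurerCartan (tangentMap IQ IG g V))) := by
    have e1 : (⟨1, maurerCartan (tangentMap IQ IG g V)⟩ : TangentBundle IG G) =
        tangentMap IG IG (fun x => x * (g V.1)⁻¹) (tangentMap IQ IG g V) :=
      tangentBundle_mk_congr (EM := EG) (mul_inv_cancel (g V.1)).symm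
        (maurerCartan (tangentMap IQ IG g V))
    rw [fundamentalVector, e1,
      ← tangentMap_comp_apply (g := fun x => B.act (m V.1) x)
        ((B.contMDiff_act_right _).mdifferentiableAt (by simp))
        (mdifferentiable_mul_right' _ _),
      ← tangentMap_comp_apply (g := fun p => B.act p (g V.1))
        ((B.contMDiff_act_left _).mdifferentiableAt (by simp))
        (f := fun x => B.act (m V.1) (x * (g V.1)⁻¹)) (((B.contMDiff_act_right _).comp
          (contMDiff_mul_right (I := IG) (n := ∞))).mdifferentiableAt (by simp))]
    congr 1
    funext x
    rw [← B.act_mul, inv_mul_cancel_right]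
  rw [h2, h3, map_add]
  refine congrArg₂ (fun a b => a + b) (hθ.equivariant (m V.1) (g V.1) _) ?_
  refine (hθ.equivariant _ (g V.1) _).trans ?_
  congr 1
  exact (B.form_fundamental θ _ _).symm.trans (hθ.vertical _ _)

end PrincipalBundle

end PrincipalBundles

/-! ### Principal 2-bundles: modifying a strict connection by an `L(H)`-valued form -/

section TwoBundles

variable {E1 M1 E0 M0 EG MG EH MH EP MP EQ MQ : Type*}
  [NormedAddCommGroup E1] [NormedSpace ℝ E1] [TopologicalSpace M1]
  [NormedAddCommGroup E0] [NormedSpace ℝ E0] [TopologicalSpace M0]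
  [NormedAddCommGroup EG] [NormedSpace ℝ EG] [TopologicalSpace MG]
  [NormedAddCommGroup EH] [NormedSpace ℝ EH] [TopologicalSpace MH]
  [NormedAddCommGroup EP] [NormedSpace ℝ EP] [TopologicalSpace MP]
  [NormedAddCommGroup EQ] [NormedSpace ℝ EQ] [TopologicalSpace MQ]
  {I1 : ModelWithCorners ℝ E1 M1} {I0 : ModelWithCorners ℝ E0 M0}
  {X1 X0 : Type*} [TopologicalSpace X1] [ChartedSpace M1 X1]
  [TopologicalSpace X0] [ChartedSpace M0 X0]
  {IG : ModelWithCorners ℝ EG MG} {IH : ModelWithCorners ℝ EH MH} {G H : Type*}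
  [TopologicalSpace G] [ChartedSpace MG G] [Group G]
  [TopologicalSpace H] [ChartedSpace MH H] [Group H]
  {C : LieCrossedModule IG IH G H} {X : LieGroupoid I1 I0 X1 X0}
  {IQ : ModelWithCorners ℝ EQ MQ} {IP : ModelWithCorners ℝ EP MP} {Q P : Type*}
  [TopologicalSpace Q] [ChartedSpace MQ Q] [TopologicalSpace P] [ChartedSpace MP P]

open LieCrossedModule

/-- Differentiating the compositions of curves: sources and targets of a composable pair of tangent
vectors and of its composite. -/
theorem LieGroupoid.TangentComp.src_tgt {X : LieGroupoid I1 I0 X1 X0}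
    {V₂ V₁ V : TangentBundle I1 X1} (h : X.TangentComp V₂ V₁ V) :
    tangentMap I1 I0 X.s V₂ = tangentMap I1 I0 X.t V₁ ∧
    tangentMap I1 I0 X.s V = tangentMap I1 I0 X.s V₁ ∧
    tangentMap I1 I0 X.t V = tangentMap I1 I0 X.t V₂ := by
  obtain ⟨c₂, c₁, h₂, h₁, hc, rfl, rfl, rfl⟩ := h
  have hcomp : ContMDiff 𝓘(ℝ, ℝ) I1 ∞ (fun r => X.comp (c₂ r) (c₁ r)) := by
    have := X.contMDiffOn_comp.comp_contMDiff (h₂.prodMk h₁) hc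
    exact this
  have key : ∀ (c : ℝ → X1) (f : C^∞⟮I1, X1; I0, X0⟯), ContMDiff 𝓘(ℝ, ℝ) I1 ∞ c →
      tangentMap I1 I0 f (velocity I1 c) = velocity I0 (fun r => f (c r)) := fun c f h =>
    (tangentMap_comp_apply (V := (⟨0, (1 : ℝ)⟩ : TangentBundle 𝓘(ℝ, ℝ) ℝ))
      (f.contMDiff.mdifferentiableAt (by simp)) (h.mdifferentiableAt (by simp))).symm
  rw [key _ _ h₂, key _ _ h₁, key _ _ hcomp, key _ _ hcomp, key _ _ h₁, key _ _ h₂]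
  refine ⟨?_, ?_, ?_⟩
  · congr 1; funext r; exact hc r
  · congr 1; funext r; exact X.s_comp _ _ (hc r)
  · congr 1; funext r; exact X.t_comp _ _ (hc r)

theorem LieGroupoid.tangentMap_src_unit (X : LieGroupoid I1 I0 X1 X0) (V : TangentBundle I0 X0) :
    tangentMap I1 I0 X.s (tangentMap I0 I1 X.unit V) = V := by
  rw [← tangentMap_comp_apply (X.s.contMDiff.mdifferentiableAt (by simp))
    (X.unit.contMDiff.mdifferentiableAt (by simp))]
  simp only [X.s_unit]
  exact congrFun tangentMap_id V

theorem LieGroupoid.tangentMap_tgt_unit (X : LieGroupoid I1 I0 X1 X0) (V : TangentBundle I0 X0) :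
    tangentMap I1 I0 X.t (tangentMap I0 I1 X.unit V) = V := by
  rw [← tangentMap_comp_apply (X.t.contMDiff.mdifferentiableAt (by simp))
    (X.unit.contMDiff.mdifferentiableAt (by simp))]
  simp only [X.t_unit]
  exact congrFun tangentMap_id V

namespace Principal2Bundle

variable (B : Principal2Bundle C X IQ IP Q P)

theorem tangentMap_src_act (k : C.Mor) (V : TangentBundle IQ Q) :
    tangentMap IQ IP B.gpd.s (tangentMap IQ IQ (fun γ => B.mor.act γ k) V) =
      tangentMap IP IP (fun p => B.obj.act p k.src) (tangentMap IQ IP B.gpd.s V) := by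
  rw [← tangentMap_comp_apply (B.gpd.s.contMDiff.mdifferentiableAt (by simp))
      ((B.mor.contMDiff_act_left k).mdifferentiableAt (by simp)),
    ← tangentMap_comp_apply (g := fun p => B.obj.act p k.src)
      ((B.obj.contMDiff_act_left k.src).mdifferentiableAt (by simp))
      (B.gpd.s.contMDiff.mdifferentiableAt (by simp))]
  simp only [B.act_s]

theorem tangentMap_tgt_act (k : C.Mor) (V : TangentBundle IQ Q) :
    tangentMap IQ IP B.gpd.t (tangentMap IQ IQ (fun γ => B.mor.act γ k) V) =
      tangentMap IP IP (fun p => B.obj.act p k.tgt) (tangentMap IQ IP B.gpd.t V) := by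
  rw [← tangentMap_comp_apply (B.gpd.t.contMDiff.mdifferentiableAt (by simp))
      ((B.mor.contMDiff_act_left k).mdifferentiableAt (by simp)),
    ← tangentMap_comp_apply (g := fun p => B.obj.act p k.tgt)
      ((B.obj.contMDiff_act_left k.tgt).mdifferentiableAt (by simp))
      (B.gpd.t.contMDiff.mdifferentiableAt (by simp))]
  simp only [B.act_t]

variable [LieGroup IG ∞ G] [LieGroup IH ∞ H]

/-- The source map is equivariant along the source homomorphism; differentiate this in the group
variable at `1`. -/
theorem tangentMap_src_fundamentalVector (γ : Q) (K : GroupLieAlgebra (IH.prod IG) C.Mor) :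
    tangentMap IQ IP B.gpd.s (B.mor.fundamentalVector γ K) =
      B.obj.fundamentalVector (B.gpd.s γ) (lieSrc K) := by
  have e : (⟨1, lieSrc K⟩ : TangentBundle IG G) = tangentMap (IH.prod IG) IG C.srcHom
      (⟨1, K⟩ : TangentBundle (IH.prod IG) C.Mor) := by
    rw [lieSrc_eq_lieMap]
    exact tangentBundle_mk_congr (map_one C.srcHom).symm _
  rw [PrincipalBundle.fundamentalVector, PrincipalBundle.fundamentalVector, e,
    ← tangentMap_comp_apply (B.gpd.s.contMDiff.mdifferentiableAt (by simp))
      ((B.mor.contMDiff_act_right γ).mdifferentiableAt (by simp)),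
    ← tangentMap_comp_apply ((B.obj.contMDiff_act_right _).mdifferentiableAt (by simp))
      (C.contMDiff_srcHom.mdifferentiableAt (by simp))]
  simp only [B.act_s]
  rfl

theorem tangentMap_tgt_fundamentalVector (γ : Q) (K : GroupLieAlgebra (IH.prod IG) C.Mor) :
    tangentMap IQ IP B.gpd.t (B.mor.fundamentalVector γ K) =
      B.obj.fundamentalVector (B.gpd.t γ) (lieTgt K) := by
  have e : (⟨1, lieTgt K⟩ : TangentBundle IG G) = tangentMap (IH.prod IG) IG C.tgtHom
      (⟨1, K⟩ : TangentBundle (IH.prod IG) C.Mor) := by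
    rw [lieTgt_eq_lieMap]
    exact tangentBundle_mk_congr (map_one C.tgtHom).symm _
  rw [PrincipalBundle.fundamentalVector, PrincipalBundle.fundamentalVector, e,
    ← tangentMap_comp_apply (B.gpd.t.contMDiff.mdifferentiableAt (by simp))
      ((B.mor.contMDiff_act_right γ).mdifferentiableAt (by simp)),
    ← tangentMap_comp_apply ((B.obj.contMDiff_act_right _).mdifferentiableAt (by simp))
      (C.contMDiff_tgtHom.mdifferentiableAt (by simp))]
  simp only [B.act_t]
  rfl

/-- Regroups the correction `(t^*λ - s^*λ, τ(s^*λ))` as `(t^*λ, 0) + (-s^*λ, τ(s^*λ))`: a part with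
zero source and a part with zero target. -/
theorem eval_modify₁ (θ₁ : LieForm IQ Q (IH.prod IG) C.Mor) (l : LieForm IP P IH H)
    (V : TangentBundle IQ Q) :
    (B.modify₁ θ₁ l).eval V = θ₁.eval V +
      lieMap IH (IH.prod IG) C.inH (l.eval (tangentMap IQ IP B.gpd.t V)) +
      lieMap IH (IH.prod IG) C.tgtKer (l.eval (tangentMap IQ IP B.gpd.s V)) := by
  rw [lieMap_tgtKer, lieMap_inH, lieMap_inH, lieMap_inG, ← map_sub, add_assoc, ← map_add,
    Prod.mk_sub_mk, Prod.mk_add_mk, sub_zero, zero_add, zero_sub, ← sub_eq_add_neg]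
  rfl

theorem eval_modify₀ (θ₀ : LieForm IP P IG G) (l : LieForm IP P IH H) (V : TangentBundle IP P) :
    (modify₀ C θ₀ l).eval V = θ₀.eval V + C.lieτ (l.eval V) := rfl

variable [IsManifold IQ ∞ Q] [IsManifold IP ∞ P]
variable {B} {θ₁ : LieForm IQ Q (IH.prod IG) C.Mor} {θ₀ : LieForm IP P IG G}
  {l : LieForm IP P IH H}

/-- The source sees only the `tgtKer` part and the target only the `inH` part, each contributing
`τ(λ)` at the correct endpoint. On units both endpoints agree and the two parts add up to `inG
(τ(λ))`. -/
theorem isForm_modify (hθ : B.gpd.IsForm C θ₁ θ₀) (hl : l.IsSmooth) :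
    B.gpd.IsForm C (B.modify₁ θ₁ l) (modify₀ C θ₀ l) where
  smooth₁ := by
    have ht := contMDiff_vector_clm (E := EH) (F := EH × EG) (lieMap IH (IH.prod IG) C.inH)
      (ContMDiff.comp (M' := TangentBundle IP P) hl (contMDiff_tangentMap_infty B.gpd.t.contMDiff))
    have hs := contMDiff_vector_clm (E := EH) (F := EH × EG) (lieMap IH (IH.prod IG) C.tgtKer)
      (ContMDiff.comp (M' := TangentBundle IP P) hl (contMDiff_tangentMap_infty B.gpd.s.contMDiff))
    exact (contMDiff_vector_add (contMDiff_vector_add hθ.smooth₁ ht) hs).congr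
      fun V => B.eval_modify₁ θ₁ l V
  smooth₀ := by
    exact contMDiff_vector_add hθ.smooth₀
      (contMDiff_vector_clm (E := EH) (F := EG) C.lieτ hl)
  map_src γ v := by
    have h := B.eval_modify₁ θ₁ l ⟨γ, v⟩
    refine (congrArg lieSrc h).trans ?_
    rw [lieSrc_add, lieSrc_add, lieSrc_inH, lieSrc_tgtKer, add_zero]
    exact congrArg (fun A => A + C.lieτ _) (hθ.map_src γ v)
  map_tgt γ v := by
    have h := B.eval_modify₁ θ₁ l ⟨γ, v⟩
    refine (congrArg lieTgt h).trans ?_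
    rw [lieTgt_add, lieTgt_add, lieTgt_inH, lieTgt_tgtKer, add_zero]
    exact congrArg (fun A => A + C.lieτ _) (hθ.map_tgt γ v)
  map_unit x v := by
    have h := B.eval_modify₁ θ₁ l (tangentMap IP IQ B.gpd.unit ⟨x, v⟩)
    refine h.trans ?_
    rw [B.gpd.tangentMap_src_unit, B.gpd.tangentMap_tgt_unit, lieUnit_eq_lieMap, lieMap_tgtKer,
      add_assoc, add_sub_cancel]
    have h2 : θ₁.eval (tangentMap IP IQ B.gpd.unit ⟨x, v⟩) = _ :=
      (hθ.map_unit x v).trans (C.lieUnit_eq_lieMap _)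
    rw [h2, ← map_add]
    rfl
  map_comp V₂ V₁ V hV := by
    obtain ⟨h21, h1, h2⟩ := hV.src_tgt
    have h := hθ.map_comp V₂ V₁ V hV
    have hs : lieSrc (θ₁.eval V₂) = _ := hθ.map_src V₂.1 V₂.2
    rw [lieComp_eq] at h ⊢
    show (B.modify₁ θ₁ l).eval V = (B.modify₁ θ₁ l).eval V₂ + (B.modify₁ θ₁ l).eval V₁ -
      lieMap IG (IH.prod IG) C.inG (lieSrc ((B.modify₁ θ₁ l).eval V₂))
    change θ₁.eval V = θ₁.eval V₂ + θ₁.eval V₁ -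
      lieMap IG (IH.prod IG) C.inG (lieSrc (θ₁.eval V₂)) at h
    rw [eval_modify₁, eval_modify₁, eval_modify₁, lieSrc_add, lieSrc_add, lieSrc_inH,
      lieSrc_tgtKer, h, h1, h2, h21, map_add, map_add, map_zero]
    simp only [lieMap_tgtKer]
    -- At the middle object, `inH λ` from `V₁` and `tgtKer λ` from `V₂` add up to `inG (τ λ)`,
    -- because the target of `V₁` is the source of `V₂`. The unit subtracted in the composition
    -- cancels exactly this.
    abel

/-- The adjoint action reaches `inH (t^*λ)` through the target of `k` and `tgtKer (s^*λ)` through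
its source, exactly as `t` and `s` of the bundle transform. -/
theorem isEquivariantForm_modify (hθ : B.IsEquivariantForm θ₁ θ₀) (hl : l.IsSmooth)
    (hle : ∀ p g v, l (B.obj.act p g) (B.obj.actDeriv p g v) = C.lieα g⁻¹ (l p v)) :
    B.IsEquivariantForm (B.modify₁ θ₁ l) (modify₀ C θ₀ l) where
  isForm := isForm_modify hθ.isForm hl
  equivariant₁ γ k v := by
    have hle' : ∀ g (V : TangentBundle IP P),
        l.eval (tangentMap IP IP (fun p => B.obj.act p g) V) = C.lieα g⁻¹ (l.eval V) :=
      fun g V => hle V.1 g V.2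
    have h1 := hθ.equivariant₁ γ k v
    change θ₁.eval (tangentMap IQ IQ (fun γ => B.mor.act γ k) ⟨γ, v⟩) =
      lieAd (IH.prod IG) k⁻¹ (θ₁.eval ⟨γ, v⟩) at h1
    show (B.modify₁ θ₁ l).eval (tangentMap IQ IQ (fun γ => B.mor.act γ k) ⟨γ, v⟩) =
      lieAd (IH.prod IG) k⁻¹ ((B.modify₁ θ₁ l).eval ⟨γ, v⟩)
    have ht : k⁻¹.tgt = k.tgt⁻¹ := map_inv C.tgtHom k
    have hs : k⁻¹.src = k.src⁻¹ := map_inv C.srcHom k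
    rw [eval_modify₁, eval_modify₁, B.tangentMap_src_act, B.tangentMap_tgt_act, h1, hle', hle',
      map_add, map_add, lieAd_lieMap_inH, lieAd_lieMap_tgtKer, ht, hs]
  equivariant₀ p g v := by
    show θ₀ _ _ + C.lieτ (l _ _) = lieAd IG g⁻¹ (θ₀ p v + C.lieτ (l p v))
    rw [hle, hθ.equivariant₀, map_add, lieτ_lieα]

variable (B) in
/-- The natural isomorphism `κ_p(A) = (-λ(δ_p A), A + τ(λ(δ_p A)))`. -/
def modifyIso (l : LieForm IP P IH H) (p : P) :
    GroupLieAlgebra IG G →L[ℝ] GroupLieAlgebra (IH.prod IG) C.Mor :=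
  lieMap IG (IH.prod IG) C.inG + lieMap IH (IH.prod IG) C.tgtKer ∘L l p ∘L B.obj.fundamental p

theorem modifyIso_apply (p : P) (A : GroupLieAlgebra IG G) :
    B.modifyIso l p A = lieMap IG (IH.prod IG) C.inG A +
      lieMap IH (IH.prod IG) C.tgtKer (l.eval (B.obj.fundamentalVector p A)) := by
  rw [← B.obj.form_fundamental]
  rfl

/-- By strictness the modified form sends `δ_p A` to `A + τ(λ(δ_p A))`. Adding `tgtKer (λ(δ_p A))`
to the unit at `A` keeps the target `A` and moves the source to that value. -/
theorem isVerticalIso_modifyIso (hθ : B.IsStrictConnection θ₁ θ₀) (hl : l.IsSmooth)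
    (hle : ∀ p g v, l (B.obj.act p g) (B.obj.actDeriv p g v) = C.lieα g⁻¹ (l p v)) :
    B.IsVerticalIso (B.modify₁ θ₁ l) (modify₀ C θ₀ l) (B.modifyIso l) where
  smooth := by
    have h1 := contMDiff_vector_clm (E := EG) (F := EH × EG) (lieMap IG (IH.prod IG) C.inG)
      (contMDiff_snd (I := IP) (J := 𝓘(ℝ, EG)) (M := P) (N := EG) (n := ∞))
    have h2 := contMDiff_vector_clm (E := EH) (F := EH × EG) (lieMap IH (IH.prod IG) C.tgtKer)
      (ContMDiff.comp (M' := TangentBundle IP P) hl B.obj.contMDiff_fundamentalVector)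
    exact (contMDiff_vector_add h1 h2).congr fun x => modifyIso_apply x.1 x.2
  src p A := by
    have h := hθ.vertical₀ p A
    rw [PrincipalBundle.form_fundamental] at h ⊢
    rw [modifyIso_apply, eval_modify₀, lieSrc_add, lieSrc_inG, lieSrc_tgtKer, h]
  tgt p A := by
    rw [modifyIso_apply, lieTgt_add, lieTgt_inG, lieTgt_tgtKer, add_zero]
  natural γ K := by
    have h := hθ.vertical₁ γ K
    rw [PrincipalBundle.form_fundamental] at h ⊢
    -- Both composites equal `K` plus `tgtKer` of `λ` on the fundamental vector at the source; the
    -- terms at the target cancel as in the composition law.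
    rw [lieComp_eq, lieComp_eq, modifyIso_apply, modifyIso_apply, eval_modify₁, h,
      B.tangentMap_src_fundamentalVector, B.tangentMap_tgt_fundamentalVector, lieSrc_add,
      lieSrc_inG, lieSrc_tgtKer, map_add]
    simp only [lieMap_tgtKer]
    abel
  equivariant p g A := by
    have hle' : ∀ g (V : TangentBundle IP P),
        l.eval (tangentMap IP IP (fun p => B.obj.act p g) V) = C.lieα g⁻¹ (l.eval V) :=
      fun g V => hle V.1 g V.2
    have hu : (C.unit g)⁻¹ = C.inG g⁻¹ := (map_inv C.inG g).symm
    rw [modifyIso_apply, modifyIso_apply, ← B.obj.tangentMap_act_fundamentalVector, hle', hu,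
      map_add, lieAd_inG, lieAd_lieMap_tgtKer]
    rfl

theorem isSemiStrictConnection_modify (hθ : B.IsStrictConnection θ₁ θ₀) (hl : l.IsSmooth)
    (hle : ∀ p g v, l (B.obj.act p g) (B.obj.actDeriv p g v) = C.lieα g⁻¹ (l p v)) :
    B.IsSemiStrictConnection (B.modify₁ θ₁ l) (modify₀ C θ₀ l) where
  toIsEquivariantForm := isEquivariantForm_modify hθ.toIsEquivariantForm hl hle
  exists_iso := ⟨_, isVerticalIso_modifyIso hθ hl hle⟩

end Principal2Bundle

end TwoBundles

/-! ### The decorated form as a strict connection -/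

section Decorated

variable {E1 M1 E0 M0 EG MG EH MH EP MP EN MN : Type*}
  [NormedAddCommGroup E1] [NormedSpace ℝ E1] [TopologicalSpace M1]
  [NormedAddCommGroup E0] [NormedSpace ℝ E0] [TopologicalSpace M0]
  [NormedAddCommGroup EG] [NormedSpace ℝ EG] [TopologicalSpace MG]
  [NormedAddCommGroup EH] [NormedSpace ℝ EH] [TopologicalSpace MH]
  [NormedAddCommGroup EP] [NormedSpace ℝ EP] [TopologicalSpace MP]
  [NormedAddCommGroup EN] [NormedSpace ℝ EN] [TopologicalSpace MN]
  {I1 : ModelWithCorners ℝ E1 M1} {I0 : ModelWithCorners ℝ E0 M0}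
  {X1 X0 : Type*} [TopologicalSpace X1] [ChartedSpace M1 X1]
  [TopologicalSpace X0] [ChartedSpace M0 X0]
  {IG : ModelWithCorners ℝ EG MG} {IH : ModelWithCorners ℝ EH MH} {G H : Type*}
  [TopologicalSpace G] [ChartedSpace MG G] [Group G]
  [TopologicalSpace H] [ChartedSpace MH H] [Group H]
  {IP : ModelWithCorners ℝ EP MP} {P : Type*}
  [TopologicalSpace P] [ChartedSpace MP P] {X : LieGroupoid I1 I0 X1 X0}
  {IN : ModelWithCorners ℝ EN MN} {N : Type*} [TopologicalSpace N] [ChartedSpace MN N]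
  [IsManifold I1 ∞ X1] [LieGroup IG ∞ G] [LieGroup IH ∞ H] [IsManifold IP ∞ P]

namespace GroupoidPrincipalBundle

open PrincipalBundle LieCrossedModule

variable (E : GroupoidPrincipalBundle IG IP G P X) (C : LieCrossedModule IG IH G H)
  {θ : LieForm IP P IG G}

theorem contMDiff_decS :
    ContMDiff ((I1.prod IG).prod IH) IP ∞ (fun w : E.SPull × H => w.1.snd) :=
  Pullback.contMDiff_snd.comp contMDiff_fst

/-- Expresses the form through homomorphisms and the Maurer–Cartan form, so that product and
homomorphism rules apply. -/
theorem eval_decForm (θ : LieForm IP P IG G)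
    (V : TangentBundle ((I1.prod IG).prod IH) (E.SPull × H)) :
    (E.decForm C θ).eval V =
      lieAd (IH.prod IG) (C.inH V.1.2) (lieMap IG (IH.prod IG) C.inG
        (θ.eval (tangentMap ((I1.prod IG).prod IH) IP (fun w : E.SPull × H => w.1.snd) V))) -
      lieMap IH (IH.prod IG) C.inH
        (maurerCartan (tangentMap ((I1.prod IG).prod IH) IH (fun w : E.SPull × H => w.2) V)) := by
  rw [lieMap_inG, lieMap_inH]
  rfl

/-- The pullback of the decorated form along a smooth map. -/
theorem eval_decForm_tangentMap (θ : LieForm IP P IG G) {F : N → E.SPull × H}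
    {V : TangentBundle IN N} (hF : MDifferentiableAt IN ((I1.prod IG).prod IH) F V.1) :
    (E.decForm C θ).eval (tangentMap IN ((I1.prod IG).prod IH) F V) =
      lieAd (IH.prod IG) (C.inH (F V.1).2) (lieMap IG (IH.prod IG) C.inG
        (θ.eval (tangentMap IN IP (fun x => (F x).1.snd) V))) -
      lieMap IH (IH.prod IG) C.inH
        (maurerCartan (tangentMap IN IH (fun x => (F x).2) V)) := by
  rw [eval_decForm, ← tangentMap_comp_apply (g := fun w : E.SPull × H => w.1.snd)
      (E.contMDiff_decS.mdifferentiableAt (by simp)) hF,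
    ← tangentMap_comp_apply (g := fun w : E.SPull × H => w.2) mdifferentiableAt_snd hF]
  rfl

theorem isSmooth_decForm (hθ : θ.IsSmooth) : (E.decForm C θ).IsSmooth := by
  have hp : ContMDiff ((I1.prod IG).prod IH).tangent ((I1.prod IG).prod IH) ∞
      (fun V : TangentBundle ((I1.prod IG).prod IH) (E.SPull × H) => V.1) :=
    Bundle.contMDiff_proj (TangentSpace ((I1.prod IG).prod IH) : E.SPull × H → Type _)
  have h1 := contMDiff_vector_clm (E := EG) (F := EH × EG) (lieMap IG (IH.prod IG) C.inG)
    (ContMDiff.comp (M' := TangentBundle IP P) hθ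
      (contMDiff_tangentMap_infty (E.contMDiff_decS (IH := IH) (H := H))))
  have h2 : ContMDiff ((I1.prod IG).prod IH).tangent (IH.prod IG) ∞
      (fun V : TangentBundle ((I1.prod IG).prod IH) (E.SPull × H) => C.inH V.1.2) :=
    C.contMDiff_inH.comp (contMDiff_snd.comp hp)
  have h3 := (contMDiff_lieAd (IG := IH.prod IG) (G := C.Mor)).comp (h2.prodMk h1)
  have h4 := contMDiff_vector_clm (E := EH) (F := EH × EG) (lieMap IH (IH.prod IG) C.inH)
    ((contMDiff_maurerCartan (IG := IH) (G := H)).comp (contMDiff_tangentMap_infty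
      (contMDiff_snd (I := I1.prod IG) (J := IH) (M := E.SPull) (N := H))))
  exact (contMDiff_vector_sub h3 h4).congr fun V => E.eval_decForm C θ V

variable {E}

/-- The invariance of `ω` under the groupoid action, pulled back from `s^*P` to `s^*P × H`; this is
the only use of that hypothesis. -/
theorem IsConnection.eval_μ (hθ : E.IsConnection θ)
    (V : TangentBundle ((I1.prod IG).prod IH) (E.SPull × H)) :
    θ.eval (tangentMap ((I1.prod IG).prod IH) IP (fun w : E.SPull × H => E.μ w.1) V) =
      θ.eval (tangentMap ((I1.prod IG).prod IH) IP (fun w : E.SPull × H => w.1.snd) V) := by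
  rw [tangentMap_comp_apply (g := E.μ) (f := fun w : E.SPull × H => w.1)
      (E.μ.contMDiff.mdifferentiableAt (by simp)) mdifferentiableAt_fst,
    tangentMap_comp_apply (g := (Pullback.snd : E.SPull → P)) (f := fun w : E.SPull × H => w.1)
      (Pullback.contMDiff_snd.mdifferentiableAt (by simp)) mdifferentiableAt_fst]
  exact (hθ.pullback_eq _ _).symm

/-- Apply `eval_act` to `μ(γ, p) · τ(h⁻¹)`. The rule for inverses turns the varying factor into `-τ
(MC K)` after the outer `Ad_{τ h}`, and `eval_μ` replaces `μ(γ, p)` by `p`. -/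
theorem IsConnection.lieTgt_decForm (hθ : E.IsConnection θ)
    (V : TangentBundle ((I1.prod IG).prod IH) (E.SPull × H)) :
    lieTgt ((E.decForm C θ).eval V) =
      θ.eval (tangentMap ((I1.prod IG).prod IH) IP (E.decT C) V) := by
  have hi : MDifferentiableAt ((I1.prod IG).prod IH) IH (fun w : E.SPull × H => w.2⁻¹) V.1 :=
    (contMDiff_snd.inv (n := ∞)).mdifferentiableAt (by simp)
  have hm : MDifferentiableAt ((I1.prod IG).prod IH) IP (fun w : E.SPull × H => E.μ w.1) V.1 :=
    (E.μ.contMDiff.comp contMDiff_fst).mdifferentiableAt (by simp)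
  have hg : MDifferentiableAt ((I1.prod IG).prod IH) IG
      (fun w : E.SPull × H => C.τ w.2⁻¹) V.1 :=
    (C.contMDiff_τ.comp (contMDiff_snd.inv)).mdifferentiableAt (by simp)
  have h1 := hθ.toIsConnection.eval_act hm hg
  refine Eq.trans ?_ h1.symm
  have ht : (C.inH V.1.2).tgt = C.τ V.1.2 := mul_one _
  rw [hθ.eval_μ, maurerCartan_hom C.contMDiff_τ hi, maurerCartan_inv mdifferentiableAt_snd,
    eval_decForm, lieTgt_sub, lieTgt_lieAd, lieTgt_inG, lieTgt_inH, ht, map_neg, map_add, map_neg,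
    lieMap_lieAd C.contMDiff_τ, ← lieAd_mul]
  simp only [map_inv, inv_inv, mul_inv_cancel]
  rw [lieAd_one, ← sub_eq_add_neg]
  rfl

/-- The source of `inH h` is `1`, so the adjoint factor disappears, and the Maurer–Cartan term lies
in the kernel of the source. -/
theorem lieSrc_decForm (θ : LieForm IP P IG G)
    (V : TangentBundle ((I1.prod IG).prod IH) (E.SPull × H)) :
    lieSrc ((E.decForm C θ).eval V) =
      θ.eval (tangentMap ((I1.prod IG).prod IH) IP (fun w : E.SPull × H => w.1.snd) V) := by
  have h : C.srcHom (C.inH V.1.2) = 1 := rfl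
  rw [eval_decForm, lieSrc_sub, lieSrc_inH, sub_zero, lieSrc_eq_lieMap,
    lieMap_lieAd C.contMDiff_srcHom, h, lieAd_one, ← lieSrc_eq_lieMap, lieSrc_inG]

theorem IsConnection.isForm_decForm (hθ : E.IsConnection θ) :
    (E.decorated C).gpd.IsForm C (E.decForm C θ) θ where
  smooth₁ := E.isSmooth_decForm C hθ.smooth
  smooth₀ := hθ.smooth
  map_src γ v := lieSrc_decForm C θ ⟨γ, v⟩
  map_tgt γ v := hθ.lieTgt_decForm C ⟨γ, v⟩
  map_unit x v := by
    have h := E.eval_decForm_tangentMap C θ (V := (⟨x, v⟩ : TangentBundle IP P))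
      ((E.decorated C).gpd.unit.contMDiff.mdifferentiableAt (by simp))
    refine h.trans ?_
    have e1 : C.inH ((E.decorated C).gpd.unit x).2 = 1 := rfl
    have e2 : tangentMap IP IH (fun p => ((E.decorated C).gpd.unit p).2)
        (⟨x, v⟩ : TangentBundle IP P) = ⟨1, 0⟩ := tangentMap_const_snd (1 : H) _
    have e3 : tangentMap IP IP (fun p => ((E.decorated C).gpd.unit p).1.snd)
        (⟨x, v⟩ : TangentBundle IP P) = ⟨x, v⟩ := congrFun tangentMap_id _
    rw [e1, lieAd_one, e2, e3, maurerCartan_one, map_zero, sub_zero, lieUnit_eq_lieMap]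
    rfl
  map_comp V₂ V₁ V hV := by
    have h21 := hV.src_tgt.1
    obtain ⟨c₂, c₁, h₂, h₁, hc, rfl, rfl, rfl⟩ := hV
    have hc' : ∀ r, (c₂ r).1.snd = E.decT C (c₁ r) := hc
    have hcomp : ContMDiff 𝓘(ℝ, ℝ) ((I1.prod IG).prod IH) ∞
        (fun r => (E.decorated C).gpd.comp (c₂ r) (c₁ r)) :=
      (E.decorated C).gpd.contMDiffOn_comp.comp_contMDiff (h₂.prodMk h₁) hc
    let R : TangentBundle 𝓘(ℝ, ℝ) ℝ := ⟨0, (1 : ℝ)⟩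
    set K₂ := (E.decForm C θ).eval (tangentMap 𝓘(ℝ, ℝ) ((I1.prod IG).prod IH) c₂ R) with hK₂
    set K₁ := (E.decForm C θ).eval (tangentMap 𝓘(ℝ, ℝ) ((I1.prod IG).prod IH) c₁ R) with hK₁
    show (E.decForm C θ).eval (tangentMap 𝓘(ℝ, ℝ) ((I1.prod IG).prod IH)
      (fun r => (E.decorated C).gpd.comp (c₂ r) (c₁ r)) R) = lieComp K₂ K₁
    have hs : lieSrc K₂ = lieTgt K₁ := by
      rw [hK₂, hK₁, lieSrc_decForm, hθ.lieTgt_decForm]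
      exact congrArg θ.eval h21
    have d₂ : MDifferentiableAt 𝓘(ℝ, ℝ) ((I1.prod IG).prod IH) c₂ R.1 :=
      h₂.mdifferentiableAt (by simp)
    have d₁ : MDifferentiableAt 𝓘(ℝ, ℝ) ((I1.prod IG).prod IH) c₁ R.1 :=
      h₁.mdifferentiableAt (by simp)
    have e2 := E.eval_decForm_tangentMap C θ d₂
    have e1 := E.eval_decForm_tangentMap C θ d₁
    rw [← hK₂] at e2
    rw [← hK₁] at e1
    have eB : lieMap IG (IH.prod IG) C.inG (lieSrc K₂) = lieMap IG (IH.prod IG) C.inG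
        (θ.eval (tangentMap 𝓘(ℝ, ℝ) IP (fun r => (c₂ r).1.snd) R)) := by
      rw [hK₂, lieSrc_decForm, ← tangentMap_comp_apply (g := fun w : E.SPull × H => w.1.snd)
        (E.contMDiff_decS.mdifferentiableAt (by simp)) d₂]
    have f1 : (fun r => ((E.decorated C).gpd.comp (c₂ r) (c₁ r)).1.snd) =
        fun r => (c₁ r).1.snd := funext fun r => E.decComp_snd C (hc' r)
    have f2 : (fun r => ((E.decorated C).gpd.comp (c₂ r) (c₁ r)).2) =
        fun r => (c₂ r).2 * (c₁ r).2 := funext fun r => E.decComp_H C (hc' r)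
    have f3 := congrFun f2 R.1
    -- The value on the composite is `Ad_{inH h₂} K₁` minus the Maurer–Cartan term of `h₂`. This
    -- fact says that `Ad_{inH h₂}` changes `K₁` only through the unit at its target.
    have key := lieAd_inH_sub (c₂ R.1).2 K₁
    have g₂ : MDifferentiableAt 𝓘(ℝ, ℝ) IH (fun r => (c₂ r).2) R.1 :=
      (contMDiff_snd.comp h₂).mdifferentiableAt (by simp)
    have g₁ : MDifferentiableAt 𝓘(ℝ, ℝ) IH (fun r => (c₁ r).2) R.1 :=
      (contMDiff_snd.comp h₁).mdifferentiableAt (by simp)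
    have hAd : ∀ (h : H) (A : GroupLieAlgebra IH H),
        lieMap IH (IH.prod IG) C.inH (lieAd IH h A) =
          lieAd (IH.prod IG) (C.inH h) (lieMap IH (IH.prod IG) C.inH A) :=
      lieMap_lieAd C.contMDiff_inH
    rw [E.eval_decForm_tangentMap C θ (hcomp.mdifferentiableAt (by simp)), f1, f2, f3,
      maurerCartan_mul g₂ g₁, map_mul, lieAd_mul, map_add, hAd, sub_add_eq_sub_sub, sub_right_comm,
      ← map_sub, ← e1, lieComp_eq]
    -- Composability identifies the target of `K₁` with the source of `K₂`, so the unit term under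
    -- `Ad_{inH h₂}` is precisely the one occurring in `K₂`.
    rw [← hs, map_sub, eB, sub_eq_iff_eq_add] at key
    rw [key, eB, e2]
    abel

variable (E) in
-- The action on the `H`-coordinate becomes a product in `H ⋊ G`, so one application of the product
-- rule handles each of the two derivatives of the action.
theorem inH_decAct (z : E.SPull × H) (k : C.Mor) :
    C.inH (E.decAct C z k).2 = k⁻¹ * C.inH z.2 * C.inG k.src := by
  refine Prod.ext ?_ ?_
  · show C.α k.2⁻¹ (k.1⁻¹ * z.2) =
      C.α k.2⁻¹ k.1⁻¹ * C.α k.2⁻¹ z.2 * C.α (k.2⁻¹ * 1) 1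
    rw [map_mul, map_one, mul_one]
  · show (1 : G) = k.2⁻¹ * 1 * k.2
    group

/-- With `k` fixed, only `inH h` varies in `k⁻¹ · inH h · inG (src k)`, so its Maurer–Cartan term is
changed by `Ad_{k⁻¹}`. In the other term `Ad_{inG (src k)}` undoes the factor `Ad_{(src k)⁻¹}`
coming from the equivariance of `ω`. -/
theorem IsConnection.equivariant_decForm (hθ : E.IsConnection θ) (k : C.Mor)
    (V : TangentBundle ((I1.prod IG).prod IH) (E.SPull × H)) :
    (E.decForm C θ).eval (tangentMap ((I1.prod IG).prod IH) ((I1.prod IG).prod IH)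
      (fun γ => (E.decorated C).mor.act γ k) V) =
      lieAd (IH.prod IG) k⁻¹ ((E.decForm C θ).eval V) := by
  have hF := (E.decorated C).mor.contMDiff_act_left k
  have hS : MDifferentiableAt ((I1.prod IG).prod IH) (IH.prod IG)
      (fun w : E.SPull × H => C.inH w.2) V.1 :=
    (C.contMDiff_inH.comp contMDiff_snd).mdifferentiableAt (by simp)
  have hk : MDifferentiableAt ((I1.prod IG).prod IH) (IH.prod IG)
      (fun w : E.SPull × H => k⁻¹ * C.inH w.2) V.1 :=
    (contMDiff_const.mul (C.contMDiff_inH.comp contMDiff_snd)).mdifferentiableAt (n := ∞) (by simp)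
  have hH : MDifferentiableAt ((I1.prod IG).prod IH) IH
      (fun w : E.SPull × H => ((E.decorated C).mor.act w k).2) V.1 :=
    (contMDiff_snd.comp hF).mdifferentiableAt (by simp)
  have h1 : θ.eval (tangentMap ((I1.prod IG).prod IH) IP
      (fun w : E.SPull × H => ((E.decorated C).mor.act w k).1.snd) V) =
      lieAd IG k.src⁻¹ (θ.eval (tangentMap ((I1.prod IG).prod IH) IP
        (fun w : E.SPull × H => w.1.snd) V)) := by
    refine Eq.trans ?_ (hθ.equivariant _ k.src _)
    exact congrArg θ.eval (tangentMap_comp_apply (g := fun p => E.act p k.src)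
      (f := fun w : E.SPull × H => w.1.snd)
      ((E.contMDiff_act_left k.src).mdifferentiableAt (by simp))
      (E.contMDiff_decS.mdifferentiableAt (by simp)))
  have e : (fun w : E.SPull × H => C.inH ((E.decorated C).mor.act w k).2) =
      fun w => k⁻¹ * C.inH w.2 * C.inG k.src := funext fun w => E.inH_decAct C w k
  have e' : C.inH ((E.decorated C).mor.act V.1 k).2 = _ := E.inH_decAct C V.1 k
  rw [E.eval_decForm_tangentMap C θ (hF.mdifferentiableAt (by simp)), h1,
    ← maurerCartan_hom C.contMDiff_inH hH, e, e',
    maurerCartan_mul hk mdifferentiableAt_const, maurerCartan_const, map_zero, add_zero,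
    maurerCartan_mul mdifferentiableAt_const hS, maurerCartan_const, zero_add,
    maurerCartan_hom C.contMDiff_inH mdifferentiableAt_snd, eval_decForm, map_sub,
    ← lieAd_inG, ← lieAd_mul, ← lieAd_mul, map_inv, mul_inv_cancel_right]

/-- Differentiating `k⁻¹ · inH h · inG (src k)` at `k = 1` gives the Maurer–Cartan term `-K +
Ad_{inH h} (inG (src K))`. Its second part cancels the connection term, whose value is `Ad_{inH h}
(inG (src K))` by verticality of `ω`, and `K` remains. -/
theorem IsConnection.vertical_decForm (hθ : E.IsConnection θ) (γ : E.SPull × H)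
    (K : GroupLieAlgebra (IH.prod IG) C.Mor) :
    (E.decForm C θ).eval ((E.decorated C).mor.fundamentalVector γ K) = K := by
  have hF := (E.decorated C).mor.contMDiff_act_right γ
  let V : TangentBundle (IH.prod IG) C.Mor := ⟨1, K⟩
  have hi : MDifferentiableAt (IH.prod IG) (IH.prod IG) (fun k : C.Mor => k⁻¹) V.1 :=
    (contMDiff_inv (IH.prod IG) ∞).mdifferentiableAt (by simp)
  have hk : MDifferentiableAt (IH.prod IG) (IH.prod IG)
      (fun k : C.Mor => k⁻¹ * C.inH γ.2) V.1 :=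
    ((contMDiff_inv (IH.prod IG) ∞).mul contMDiff_const).mdifferentiableAt (by simp)
  have hs : MDifferentiableAt (IH.prod IG) IG C.srcHom V.1 :=
    C.contMDiff_srcHom.mdifferentiableAt (by simp)
  have hg : MDifferentiableAt (IH.prod IG) (IH.prod IG)
      (fun k : C.Mor => C.inG (C.srcHom k)) V.1 :=
    (C.contMDiff_inG.comp C.contMDiff_srcHom).mdifferentiableAt (by simp)
  have hH : MDifferentiableAt (IH.prod IG) IH
      (fun k : C.Mor => ((E.decorated C).mor.act γ k).2) V.1 :=
    (contMDiff_snd.comp hF).mdifferentiableAt (by simp)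
  have h1 : θ.eval (tangentMap (IH.prod IG) IP
      (fun k : C.Mor => ((E.decorated C).mor.act γ k).1.snd) V) = lieSrc K := by
    have h := (E.decorated C).tangentMap_src_fundamentalVector γ K
    rw [fundamentalVector, ← tangentMap_comp_apply
      ((E.decorated C).gpd.s.contMDiff.mdifferentiableAt (by simp))
      (hF.mdifferentiableAt (by simp))] at h
    refine (congrArg θ.eval h).trans ?_
    exact (E.form_fundamental θ _ _).symm.trans (hθ.vertical _ _)
  have e : (fun k : C.Mor => C.inH ((E.decorated C).mor.act γ k).2) =
      fun k => k⁻¹ * C.inH γ.2 * C.inG (C.srcHom k) := funext fun k => E.inH_decAct C γ k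
  have e1 : C.inH ((E.decorated C).mor.act γ V.1).2 = C.inH γ.2 :=
    congrArg (fun z : E.SPull × H => C.inH z.2) ((E.decorated C).mor.act_one γ)
  have e2 : tangentMap (IH.prod IG) (IH.prod IG) (fun k : C.Mor => k) V = V :=
    congrFun tangentMap_id V
  have e3 : maurerCartan V = K := maurerCartan_one K
  have e4 : maurerCartan (tangentMap (IH.prod IG) IG C.srcHom V) = lieSrc K := by
    rw [lieSrc_eq_lieMap, lieMap_eq_maurerCartan C.contMDiff_srcHom]
  have e5 : V.1⁻¹ = 1 := inv_one
  rw [fundamentalVector, E.eval_decForm_tangentMap C θ (hF.mdifferentiableAt (by simp)), h1,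
    ← maurerCartan_hom C.contMDiff_inH hH, e, e1,
    maurerCartan_mul hk hg, maurerCartan_mul hi mdifferentiableAt_const, maurerCartan_const,
    map_zero, add_zero, maurerCartan_inv (f := fun k : C.Mor => k) mdifferentiableAt_id, e2, e3,
    maurerCartan_hom C.contMDiff_inG hs, e4, e5, one_mul, lieAd_one]
  abel

theorem IsConnection.isStrictConnection_decForm (hθ : E.IsConnection θ) :
    (E.decorated C).IsStrictConnection (E.decForm C θ) θ where
  isForm := hθ.isForm_decForm C
  equivariant₁ γ k v := hθ.equivariant_decForm C k ⟨γ, v⟩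
  equivariant₀ := hθ.equivariant
  vertical₁ γ K :=
    ((E.decorated C).mor.form_fundamental (E.decForm C θ) γ K).trans (hθ.vertical_decForm C γ K)
  vertical₀ := hθ.vertical

end GroupoidPrincipalBundle

end Decorated

end

theorem mainTheorem6
    {E1 M1 E0 M0 EG MG EH MH EP MP : Type*}
    [NormedAddCommGroup E1] [NormedSpace ℝ E1] [FiniteDimensional ℝ E1] [TopologicalSpace M1]
    [NormedAddCommGroup E0] [NormedSpace ℝ E0] [FiniteDimensional ℝ E0] [TopologicalSpace M0]
    [NormedAddCommGroup EG] [NormedSpace ℝ EG] [FiniteDimensional ℝ EG] [TopologicalSpace MG]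
    [NormedAddCommGroup EH] [NormedSpace ℝ EH] [FiniteDimensional ℝ EH] [TopologicalSpace MH]
    [NormedAddCommGroup EP] [NormedSpace ℝ EP] [FiniteDimensional ℝ EP] [TopologicalSpace MP]
    {I1 : ModelWithCorners ℝ E1 M1} [I1.Boundaryless]
    {I0 : ModelWithCorners ℝ E0 M0} [I0.Boundaryless]
    {IG : ModelWithCorners ℝ EG MG} [IG.Boundaryless]
    {IH : ModelWithCorners ℝ EH MH} [IH.Boundaryless]
    {IP : ModelWithCorners ℝ EP MP} [IP.Boundaryless]
    {X1 X0 G H P : Type*}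
    [TopologicalSpace X1] [ChartedSpace M1 X1] [IsManifold I1 ∞ X1]
    [T2Space X1] [SecondCountableTopology X1]
    [TopologicalSpace X0] [ChartedSpace M0 X0] [IsManifold I0 ∞ X0]
    [T2Space X0] [SecondCountableTopology X0]
    [TopologicalSpace P] [ChartedSpace MP P] [IsManifold IP ∞ P]
    [T2Space P] [SecondCountableTopology P]
    [TopologicalSpace G] [ChartedSpace MG G] [Group G] [LieGroup IG ∞ G]
    [T2Space G] [SecondCountableTopology G]
    [TopologicalSpace H] [ChartedSpace MH H] [Group H] [LieGroup IH ∞ H]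
    [T2Space H] [SecondCountableTopology H]
    (C : LieCrossedModule IG IH G H)
    (X : LieGroupoid I1 I0 X1 X0)
    (E : GroupoidPrincipalBundle IG IP G P X)
    (θ : LieForm IP P IG G) (hθ : E.IsConnection θ) :
    (E.decorated C).IsStrictConnection (E.decForm C θ) θ ∧
    ∀ l : LieForm IP P IH H, l.IsSmooth →
      (∀ p g v, l (E.act p g) (E.actDeriv p g v) = C.lieα g⁻¹ (l p v)) →
      (E.decorated C).IsSemiStrictConnection
        ((E.decorated C).modify₁ (E.decForm C θ) l) (Principal2Bundle.modify₀ C θ l) :=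
  ⟨hθ.isStrictConnection_decForm C, fun _ hl hle =>
    Principal2Bundle.isSemiStrictConnection_modify (hθ.isStrictConnection_decForm C) hl hle⟩
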